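/- **Setting.** Let $\mathbb K$ be a field, $N\ge 1$, and let $A=\mathbb K[X_1][X_2;\sigma_2,\delta_2]\cdots[X_N;\sigma_N,\delta_N]$ be an iterated Ore extension with $\mathbb K$-linear automorphisms $\sigma_i$ and left $\sigma_i$-derivations $\delta_i$ of $A_{i-1}:=\mathbb K[X_1]\cdots[X_{i-1};\sigma_{i-1},\delta_{i-1}]$ (so $X_i r=\sigma_i(r)X_i+\delta_i(r)$ for $r \in A_{i-1}$), such that: * $\sigma_i(X_l)=\lambda_{i,l}X_l$ for $1\le l<i\le N$, where $(\lambda_{i,l})\in M_N(\mathbb K^*)$ and $\lambda_{i,l}=\lambda_{l,i}^{-1}$ for all $i,l$; * for $2\le i\le N$ there is $q_i\in\mathbb K^*$, $q_i\ne1$, with $\delta_i\sigma_i=q_i\sigma_i\delta_i$; * for $2\le i\le N$ there is a sequence $(d_{i,n})_{n\ge0}$ of $\mathbb K$-linear operators on $A_{i-1}$ with $d_{i,0}=\mathrm{id}$, $d_{i,1}=\delta_i$, $d_{i,n}(rs)=\sum_{k=0}^n\sigma_i^{n-k}d_{i,k}(r)\,d_{i,n-k}(s)$, $d_{i,n}\sigma_i=q_i^n\sigma_id_{i,n}$,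 $d_{i,n}d_{i,m}=\binom{n+m}{m}_{q_i}d_{i,n+m}$ (Gaussian binomial coefficients), and such that for each $r\in A_{i-1}$ one has $d_{i,n}(r)=0$ for all sufficiently large $n$; moreover $\sigma_l d_{i,n}=\lambda_{l,i}^n d_{i,n}\sigma_l$ on $A_{i-1}$ for $i<l\le N$ and $n\ge0$. One such sequence is fixed for each $i$. Let $F=\mathrm{Frac}(A)$ be the division ring of fractions. Put $X_l^{(N+1)}=X_l$ and, for $j=N,N-1,\dots,2$, $$X_l^{(j)}=X_l^{(j+1)}\ (l\ge j),\qquad X_l^{(j)}=\sum_{n\ge0}q_j^{n(n+1)/2}(q_j-1)^{-n}\,\bigl(d_{j,n}\circ\sigma_j^{-n}\bigr)(X_l^{(j+1)})\,\bigl(X_j^{(j+1)}\bigr)^{-n}\ (l<j),$$ where operators on $A_{j-1}$ are transported along the algebra homomorphism $A_{j-1}\to F$ with $X_l\mapsto X_l^{(j+1)}$ ($l<j$), which identifies $A_{j-1}$ with $\mathbb K\langle X_1^{(j+1)},\dots,X_{j-1}^{(j+1)}\rangle$. Let $A^{(j)}=\mathbb K\langle X_1^{(j)},\dots,X_N^{(j)}\rangle\subseteq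 F$ for $2\le j\le N+1$, so $A^{(N+1)}=A$, and let $A'=A^{(2)}$. Write $\mathrm{C.Spec}(R)$ for the set of completely prime ideals of $R$, i.e. the proper two-sided ideals $P$ with $R/P$ a domain. For $2\le j\le N$ let $g_j:A^{(j)}\to A^{(j+1)}/\langle X_j^{(j+1)}\rangle$ be the algebra homomorphism with $X_l^{(j)}\mapsto X_l^{(j+1)}+\langle X_j^{(j+1)}\rangle$ for $1\le l\le N$, and let $\psi_j:\mathrm{C.Spec}(A^{(j+1)})\to\mathrm{C.Spec}(A^{(j)})$ be given by $$\psi_j(P)=\begin{cases}PS_j^{-1}\cap A^{(j)},\quad S_j=\{(X_j^{(j+1)})^n\mid n\ge0\}, & X_j^{(j+1)}\notin P,\\ g_j^{-1}\bigl(P/\langle X_j^{(j+1)}\rangle\bigr), & X_j^{(j+1)}\in P.\end{cases}$$ Let $f_1=\mathrm{id}_{\mathrm{C.Spec}(A')}$, $f_j=\psi_2\circ\cdots\circ\psi_j:\mathrm{C.Spec}(A^{(j+1)})\to\mathrm{C.Spec}(A')$ for $2\le j\le N$, and $\psi=f_N:\mathrm{C.Spec}(A)\to\mathrm{C.Spec}(A')$.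 **Proposition 3.9.** All these objects are well defined, that is, the transporting homomorphisms $A_{j-1}\to F$, the homomorphisms $g_j$, and the maps $\psi_j$ into $\mathrm{C.Spec}(A^{(j)})$ exist, and the maps $f_1,\dots,f_N$ are injective. For every $Q\in\mathrm{C.Spec}(A')$ the following are equivalent: 1. $Q\in\mathrm{Im}(\psi)$; 2. for every $j$ with $2\le j\le N$, $Q\in\mathrm{Im}(f_{j-1})$ and either $X_j^{(j)}=X_j^{(j+1)}\notin f_{j-1}^{-1}(Q)$ or $\ker(g_j)\subseteq f_{j-1}^{-1}(Q)$, where $f_{j-1}^{-1}(Q)$ denotes the unique preimage of $Q$ under $f_{j-1}$. -/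

import Mathlib

/-- The Gaussian binomial coefficient `n choose k` evaluated at `q`, through the `q`-Pascal
recursion. It is the value at `q` of a polynomial with integer coefficients, so that it makes sense
at roots of unity as well. -/
def gaussBinom {K : Type*} [Field K] (q : K) : ℕ → ℕ → K
  | _, 0 => 1
  | 0, _ + 1 => 0
  | n + 1, k + 1 => gaussBinom q n k + q ^ (k + 1) * gaussBinom q n (k + 1)

/-- Left `σ`-derivations of a `K`-algebra. -/
def IsSkewDerivation {K R : Type*} [Field K] [Ring R] [Algebra K R]
    (σ : R ≃ₐ[K] R) (δ : R →ₗ[K] R) : Prop :=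
  ∀ a b : R, δ (a * b) = σ a * δ b + δ a * b

/-- The pair `(σ, δ)` is `q`-skew. -/
def IsQSkew {K R : Type*} [Field K] [Ring R] [Algebra K R] (q : K)
    (σ : R ≃ₐ[K] R) (δ : R →ₗ[K] R) : Prop :=
  ∀ a : R, δ (σ a) = q • σ (δ a)

/-- The sequence `d` of `K`-linear operators is a higher `q`-skew `σ`-derivation that
extends `δ`. -/
structure IsHigherSkewDerivation {K R : Type*} [Field K] [Ring R] [Algebra K R] (q : K)
    (σ : R ≃ₐ[K] R) (δ : R →ₗ[K] R) (d : ℕ → R →ₗ[K] R) : Prop where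
  zero : ∀ r : R, d 0 r = r
  one : ∀ r : R, d 1 r = δ r
  mul : ∀ (n : ℕ) (r s : R),
    d n (r * s) = ∑ i ∈ Finset.range (n + 1), σ^[n - i] (d i r) * d (n - i) s
  skew : ∀ (n : ℕ) (r : R), d n (σ r) = q ^ n • σ (d n r)

/-- Local nilpotence of a sequence of operators: on each element almost all of them vanish. -/
def IsLocallyNilpotentSeq {K R : Type*} [Field K] [Ring R] [Algebra K R]
    (d : ℕ → R →ₗ[K] R) : Prop :=
  ∀ r : R, ∃ m : ℕ, ∀ n : ℕ, m ≤ n → d n r = 0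

/-- Iterativity: `d_n d_m = (n + m choose m)_q d_{n + m}`. -/
def IsIterativeSeq {K R : Type*} [Field K] [Ring R] [Algebra K R] (q : K)
    (d : ℕ → R →ₗ[K] R) : Prop :=
  ∀ (n m : ℕ) (r : R), d n (d m r) = gaussBinom q (n + m) m • d (n + m) r

/-- Inside a `K`-algebra `A`, the subalgebra `S` is the Ore extension `R[x; σ, δ]` of its
subalgebra `R`: it contains `R` and `x`, it is free as a left `R`-module on the powers of `x`, and
`x r = σ(r) x + δ(r)` for `r` in `R`. -/
structure IsOreExtension {K A : Type*} [Field K] [Ring A] [Algebra K A]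
    (R S : Subalgebra K A) (x : A) (σ : R ≃ₐ[K] R) (δ : R →ₗ[K] R) : Prop where
  le : R ≤ S
  mem : x ∈ S
  skewDerivation : IsSkewDerivation σ δ
  comm : ∀ r : R, x * (r : A) = (σ r : A) * x + (δ r : A)
  free : ∀ s ∈ S, ∃! p : ℕ →₀ R, s = p.sum fun n r => (r : A) * x ^ n

/-- The subalgebra generated by `X_1, ..., X_{i-1}`. -/
def below (K : Type*) {A : Type*} [Field K] [Ring A] [Algebra K A] (X : ℕ → A) (i : ℕ) :
    Subalgebra K A :=
  Algebra.adjoin K {a : A | ∃ l : ℕ, 1 ≤ l ∧ l < i ∧ X l = a}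

theorem below_mono (K : Type*) {A : Type*} [Field K] [Ring A] [Algebra K A] (X : ℕ → A)
    {i l : ℕ} (h : i ≤ l) : below K X i ≤ below K X l := by
  refine Algebra.adjoin_mono ?_
  rintro a ⟨m, h1, h2, rfl⟩
  exact ⟨m, h1, h2.trans_le h, rfl⟩

theorem mem_below (K : Type*) {A : Type*} [Field K] [Ring A] [Algebra K A] (X : ℕ → A)
    {i l : ℕ} (h1 : 1 ≤ l) (h : l < i) : X l ∈ below K X i :=
  Algebra.subset_adjoin ⟨l, h1, h, rfl⟩

/-- A quantum nilpotent algebra structure on `A`: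
`A = K[X_1][X_2; σ_2, δ_2] ... [X_N; σ_N, δ_N]`, with a chosen higher skew derivation `d_i`
extending each `δ_i`. The variables are numbered `1, ..., N`; entries of the families with an index
outside of the indicated ranges are irrelevant. The algebra `A_{i-1}`, on which `σ_i`, `δ_i` and
`d_{i,n}` live, is `below K X i`. For `i = 1` this is `K`, where necessarily `σ_1 = id` and
`δ_1 = 0`. -/
structure QuantumNilpotentAlgebra (K A : Type*) [Field K] [Ring A] [Algebra K A] (N : ℕ) where
  /-- the variables -/
  X : ℕ → A
  /-- the automorphisms -/
  σ : ∀ i : ℕ, below K X i ≃ₐ[K] below K X i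
  /-- the skew derivations -/
  δ : ∀ i : ℕ, below K X i →ₗ[K] below K X i
  /-- the commutation coefficients -/
  lam : ℕ → ℕ → Kˣ
  /-- the skewness parameters -/
  q : ℕ → Kˣ
  /-- the higher skew derivations -/
  d : ∀ i : ℕ, ℕ → below K X i →ₗ[K] below K X i
  one_le : 1 ≤ N
  nontrivial : Nontrivial A
  ore : ∀ i : ℕ, 1 ≤ i → i ≤ N →
    IsOreExtension (below K X i) (below K X (i + 1)) (X i) (σ i) (δ i)
  generates : below K X (N + 1) = ⊤
  σ_X : ∀ i l : ℕ, 2 ≤ i → i ≤ N → ∀ (h1 : 1 ≤ l) (h : l < i),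
    (σ i ⟨X l, mem_below K X h1 h⟩ : A) = (lam i l : K) • X l
  antisymm : ∀ i l : ℕ, 1 ≤ i → i ≤ N → 1 ≤ l → l ≤ N → lam i l = (lam l i)⁻¹
  q_ne_one : ∀ i : ℕ, 2 ≤ i → i ≤ N → q i ≠ 1
  qSkew : ∀ i : ℕ, 2 ≤ i → i ≤ N → IsQSkew (q i : K) (σ i) (δ i)
  higher : ∀ i : ℕ, 2 ≤ i → i ≤ N → IsHigherSkewDerivation (q i : K) (σ i) (δ i) (d i)
  locallyNilpotent : ∀ i : ℕ, 2 ≤ i → i ≤ N → IsLocallyNilpotentSeq (d i)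
  iterative : ∀ i : ℕ, 2 ≤ i → i ≤ N → IsIterativeSeq (q i : K) (d i)
  /-- `σ_l ∘ d_{i,n} = λ_{l,i}^n d_{i,n} ∘ σ_l` on `A_{i-1}`, which `σ_l` maps to itself;
  `b` is the element `σ_l(a)` of `A_{i-1}`. -/
  σ_d : ∀ i l n : ℕ, 2 ≤ i → ∀ h : i + 1 ≤ l, l ≤ N → ∀ a b : below K X i,
    (b : A) = (σ l (Subalgebra.inclusion (below_mono K X (Nat.le_of_succ_le h)) a) : A) →
    (σ l (Subalgebra.inclusion (below_mono K X (Nat.le_of_succ_le h)) (d i n a)) : A) =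
      ((lam l i : K) ^ n) • (d i n b : A)

/-- The division ring `F` is, by means of `ι`, the division ring of fractions of `A`. -/
structure IsDivisionRingOfFractions {K A F : Type*} [Field K] [Ring A] [Algebra K A]
    [DivisionRing F] [Algebra K F] (ι : A →ₐ[K] F) : Prop where
  injective : Function.Injective ι
  right : ∀ z : F, ∃ a b : A, b ≠ 0 ∧ z = ι a * (ι b)⁻¹
  left : ∀ z : F, ∃ a b : A, b ≠ 0 ∧ z = (ι b)⁻¹ * ι a

/-- The elements `X_l^{(j)}` of the division ring of fractions `F` that the deleting derivations
algorithm constructs, for `2 ≤ j ≤ N + 1` and `1 ≤ l ≤ N`. They are defined by descending recursion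
on `j`. The recursion evaluates `d_{j,n} ∘ σ_j^{-n}`, an operator on `A_{j-1}`, at `X_l^{(j+1)}`;
this refers to the identification `transport j` of `A_{j-1}` with the subalgebra generated by
`X_1^{(j+1)}, ..., X_{j-1}^{(j+1)}` that sends `X_l` to `X_l^{(j+1)}`. In the indicated ranges all
these data are determined by the conditions; outside of them they are irrelevant. The sum has only
finitely many nonzero terms, since `d_j` is locally nilpotent. -/
structure DeletingDerivations {K A F : Type*} [Field K] [Ring A] [Algebra K A]
    [DivisionRing F] [Algebra K F] {N : ℕ} (D : QuantumNilpotentAlgebra K A N)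
    (ι : A →ₐ[K] F) where
  /-- `x j l` is `X_l^{(j)}` -/
  x : ℕ → ℕ → F
  /-- the algebra homomorphism on `A_{j-1}` sending `X_l` to `X_l^{(j+1)}` -/
  transport : ∀ j : ℕ, below K D.X j →ₐ[K] F
  transport_X : ∀ j l : ℕ, 2 ≤ j → j ≤ N → ∀ (h1 : 1 ≤ l) (h : l < j),
    transport j ⟨D.X l, mem_below K D.X h1 h⟩ = x (j + 1) l
  x_start : ∀ l : ℕ, 1 ≤ l → l ≤ N → x (N + 1) l = ι (D.X l)
  x_of_ge : ∀ j l : ℕ, 2 ≤ j → j ≤ l → l ≤ N → x j l = x (j + 1) l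
  x_of_lt : ∀ j l : ℕ, 2 ≤ j → j ≤ N → ∀ (h1 : 1 ≤ l) (h : l < j),
    x j l = ∑ᶠ n : ℕ,
      (((D.q j : K) ^ (n * (n + 1) / 2)) * (((D.q j : K) - 1) ^ n)⁻¹) •
        (transport j (D.d j n ((D.σ j).symm^[n] ⟨D.X l, mem_below K D.X h1 h⟩)) *
          (x (j + 1) j ^ n)⁻¹)

/-- The completely prime spectrum: proper two-sided ideals whose quotient ring is a domain. -/
def CSpec (R : Type*) [Ring R] : Type _ :=
  {P : TwoSidedIdeal R // P ≠ ⊤ ∧ ∀ a b : R, a * b ∈ P → a ∈ P ∨ b ∈ P}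

namespace DeletingDerivations

/-- The algebra `A^{(j)}`, generated by `X_1^{(j)}, ..., X_N^{(j)}`. -/
def alg {K A F : Type*} [Field K] [Ring A] [Algebra K A] [DivisionRing F] [Algebra K F] {N : ℕ}
    {D : QuantumNilpotentAlgebra K A N} {ι : A →ₐ[K] F} (E : DeletingDerivations D ι) (j : ℕ) :
    Subalgebra K F :=
  Algebra.adjoin K {z : F | ∃ l : ℕ, 1 ≤ l ∧ l ≤ N ∧ E.x j l = z}

/-- The generator `X_l^{(j)}` as an element of `A^{(j)}`. -/
def gen {K A F : Type*} [Field K] [Ring A] [Algebra K A] [DivisionRing F] [Algebra K F] {N : ℕ}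
    {D : QuantumNilpotentAlgebra K A N} {ι : A →ₐ[K] F} (E : DeletingDerivations D ι)
    (j l : ℕ) (h1 : 1 ≤ l) (hN : l ≤ N) : E.alg j :=
  ⟨E.x j l, Algebra.subset_adjoin ⟨l, h1, hN, rfl⟩⟩

/-- The two-sided ideal of `A^{(j+1)}` generated by `X_j^{(j+1)}`. -/
def pivotIdeal {K A F : Type*} [Field K] [Ring A] [Algebra K A] [DivisionRing F] [Algebra K F]
    {N : ℕ} {D : QuantumNilpotentAlgebra K A N} {ι : A →ₐ[K] F} (E : DeletingDerivations D ι)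
    (j : ℕ) (h2 : 2 ≤ j) (hN : j ≤ N) : Ideal (E.alg (j + 1)) :=
  (TwoSidedIdeal.span {E.gen (j + 1) j (Nat.le_of_succ_le h2) hN}).asIdeal

instance {K A F : Type*} [Field K] [Ring A] [Algebra K A] [DivisionRing F] [Algebra K F]
    {N : ℕ} {D : QuantumNilpotentAlgebra K A N} {ι : A →ₐ[K] F} (E : DeletingDerivations D ι)
    (j : ℕ) (h2 : 2 ≤ j) (hN : j ≤ N) : (E.pivotIdeal j h2 hN).IsTwoSided :=
  inferInstanceAs (TwoSidedIdeal.asIdeal _).IsTwoSided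

end DeletingDerivations

/-- The maps `g_j : A^{(j)} → A^{(j+1)} / ⟨X_j^{(j+1)}⟩` and
`ψ_j : C.Spec(A^{(j+1)}) → C.Spec(A^{(j)})`, for `2 ≤ j ≤ N`. They are determined by the
conditions. -/
structure SpectrumMaps {K A F : Type*} [Field K] [Ring A] [Algebra K A]
    [DivisionRing F] [Algebra K F] {N : ℕ} {D : QuantumNilpotentAlgebra K A N}
    {ι : A →ₐ[K] F} (E : DeletingDerivations D ι) where
  /-- the homomorphism `g_j`, which sends `X_l^{(j)}` to the class of `X_l^{(j+1)}` -/
  g : ∀ (j : ℕ) (h2 : 2 ≤ j) (hN : j ≤ N),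
    E.alg j →ₐ[K] E.alg (j + 1) ⧸ E.pivotIdeal j h2 hN
  g_gen : ∀ (j : ℕ) (h2 : 2 ≤ j) (hN : j ≤ N) (l : ℕ) (h1 : 1 ≤ l) (hl : l ≤ N),
    g j h2 hN (E.gen j l h1 hl) =
      Ideal.Quotient.mk (E.pivotIdeal j h2 hN) (E.gen (j + 1) l h1 hl)
  /-- the map `ψ_j` -/
  ψ : ∀ j : ℕ, 2 ≤ j → j ≤ N → CSpec (E.alg (j + 1)) → CSpec (E.alg j)
  /-- If `X_j^{(j+1)} ∉ P`, then `ψ_j(P) = P S_j⁻¹ ∩ A^{(j)}`, where `S_j` consists of the powers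
  of `X_j^{(j+1)}`. -/
  ψ_of_notMem : ∀ (j : ℕ) (h2 : 2 ≤ j) (hN : j ≤ N) (P : CSpec (E.alg (j + 1))),
    E.gen (j + 1) j (Nat.le_of_succ_le h2) hN ∉ P.1 → ∀ a : E.alg j,
      (a ∈ (ψ j h2 hN P).1 ↔ ∃ p ∈ P.1, ∃ n : ℕ, (a : F) = (p : F) * (E.x (j + 1) j ^ n)⁻¹)
  /-- If `X_j^{(j+1)} ∈ P`, then `ψ_j(P) = g_j⁻¹(P / ⟨X_j^{(j+1)}⟩)`. -/
  ψ_of_mem : ∀ (j : ℕ) (h2 : 2 ≤ j) (hN : j ≤ N) (P : CSpec (E.alg (j + 1))),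
    E.gen (j + 1) j (Nat.le_of_succ_le h2) hN ∈ P.1 → ∀ a : E.alg j,
      (a ∈ (ψ j h2 hN P).1 ↔
        ∃ p ∈ P.1, Ideal.Quotient.mk (E.pivotIdeal j h2 hN) p = g j h2 hN a)

namespace SpectrumMaps

/-- The composite `f_{j-1} = ψ_2 ∘ ... ∘ ψ_{j-1} : C.Spec(A^{(j)}) → C.Spec(A^{(2)})`, for
`2 ≤ j ≤ N + 1`; the identity for `j = 2`. -/
def toBase {K A F : Type*} [Field K] [Ring A] [Algebra K A] [DivisionRing F] [Algebra K F]
    {N : ℕ} {D : QuantumNilpotentAlgebra K A N} {ι : A →ₐ[K] F} {E : DeletingDerivations D ι}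
    (M : SpectrumMaps E) : ∀ j : ℕ, 2 ≤ j → j ≤ N + 1 → CSpec (E.alg j) → CSpec (E.alg 2)
  | 0, h, _ => absurd h (by decide)
  | 1, h, _ => absurd h (by decide)
  | 2, _, _ => id
  | j + 3, _, hN => fun P =>
      M.toBase (j + 2) (Nat.le_add_left 2 j) (Nat.le_of_succ_le hN)
        (M.ψ (j + 2) (Nat.le_add_left 2 j) (Nat.le_of_succ_le_succ hN) P)

/-- The canonical embedding `ψ = ψ_2 ∘ ... ∘ ψ_N`, from `C.Spec(A)` to `C.Spec(A')`, where
`A = A^{(N+1)}` and `A' = A^{(2)}`. -/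
def canonicalEmbedding {K A F : Type*} [Field K] [Ring A] [Algebra K A] [DivisionRing F]
    [Algebra K F] {N : ℕ} {D : QuantumNilpotentAlgebra K A N} {ι : A →ₐ[K] F}
    {E : DeletingDerivations D ι} (M : SpectrumMaps E) :
    CSpec (E.alg (N + 1)) → CSpec (E.alg 2) :=
  M.toBase (N + 1) (Nat.succ_le_succ D.one_le) le_rfl

end SpectrumMaps

/-! Fix a step with pivot x = X_j^{(j+1)}, so that x r = σ(r) x + δ(r) over the image of A_{j-1}.
Put T_n = q^{n(n+1)/2} d_n σ^{-n}, y = ((q-1)x)^{-1} and θ(r) = Σ T_n(r) y^n. Then θ is a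
homomorphism and x θ(r) = θ(σ r) x: replacing X_l by θ(X_l) deletes δ. This rests on two identities
for T_n, `twistedOperator_mul` and `twistedOperator_map`, the second of which uses iterativity.

Since θ(r) is r plus terms in negative powers of x, leading terms show that θ is injective and that
the powers of x stay independent over its image. By local nilpotence the series can be inverted, so
A^{(j)} and A^{(j+1)} have the same localization at x (`IsStage.sameFractions`). The invariant
`IsStage` says that A_{j-1} embeds and that each variable of index at least j q-commutes with all
smaller ones and has independent powers over them; `IsStage.isStage_next` propagates it down to j =
2 and thereby supplies the transporting homomorphisms.

By the invariant A^{(j)} is obtained from A_{j-1} by q-commutation relations alone. They also hold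
in A^{(j+1)}/⟨x⟩, those involving x trivially, whence g_j. Instead of a presentation, the proof
shows that the subalgebra of a product generated by the pairs of corresponding generators is the
graph of a map.

The map ψ_j preserves whether the pivot lies in the ideal. Ideals avoiding x correspond bijectively
through the common localization; ideals containing x correspond, g_j being surjective, to those
containing ker g_j. So ψ_j is injective with image {Q : X_j^{(j)} ∉ Q or ker g_j ⊆ Q}
(`mem_range_ψ_iff`), and composing these descriptions yields the criterion. -/

/-- A subring of a division ring, parametrised by `φ`, together with a nonzero element `x` that
satisfies the relations of the Ore extension `R[x; σ, δ]`, where `δ` extends to a locally nilpotent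
iterative higher `q`-skew `σ`-derivation `d`. -/
structure OreRelations {K R F : Type*} [Field K] [Ring R] [Algebra K R] [DivisionRing F]
    [Algebra K F] (q : K) (σ : R ≃ₐ[K] R) (δ : R →ₗ[K] R) (d : ℕ → R →ₗ[K] R)
    (φ : R →ₐ[K] F) (x : F) : Prop where
  q_ne_zero : q ≠ 0
  q_ne_one : q ≠ 1
  higher : IsHigherSkewDerivation q σ δ d
  nilpotent : IsLocallyNilpotentSeq d
  iterative : IsIterativeSeq q d
  x_ne_zero : x ≠ 0
  comm : ∀ r : R, x * φ r = φ (σ r) * x + φ (δ r)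

/-! ### Gaussian binomials and the normalised operators T_n -/

theorem gaussBinom_eq_zero {K : Type*} [Field K] (q : K) :
    ∀ {n k : ℕ}, n < k → gaussBinom q n k = 0
  | _, 0, h => absurd h (Nat.not_lt_zero _)
  | 0, k + 1, _ => by simp [gaussBinom]
  | n + 1, k + 1, h => by
    rw [gaussBinom, gaussBinom_eq_zero q (Nat.lt_of_succ_lt_succ h),
      gaussBinom_eq_zero q (Nat.lt_of_succ_lt h)]
    simp

theorem gaussBinom_self {K : Type*} [Field K] (q : K) : ∀ n : ℕ, gaussBinom q n n = 1
  | 0 => by simp [gaussBinom]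
  | n + 1 => by
    rw [gaussBinom, gaussBinom_self q n, gaussBinom_eq_zero q (Nat.lt_succ_self n)]
    simp

/-- This is the coefficient in δ d_n = (1 + q + ... + q^n) d_{n+1}, multiplied by the `q - 1` that
accompanies δ in `twistedOperator_map`. -/
theorem sub_one_mul_gaussBinom_succ_self {K : Type*} [Field K] (q : K) :
    ∀ n : ℕ, (q - 1) * gaussBinom q (n + 1) n = q ^ (n + 1) - 1
  | 0 => by simp [gaussBinom]
  | n + 1 => by
    rw [gaussBinom, gaussBinom_self q (n + 1), mul_add, sub_one_mul_gaussBinom_succ_self q n]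
    ring

namespace IsHigherSkewDerivation

variable {K R : Type*} [Field K] [Ring R] [Algebra K R] {q : K} {σ : R ≃ₐ[K] R}
  {δ : R →ₗ[K] R} {d : ℕ → R →ₗ[K] R}

theorem map_symm (h : IsHigherSkewDerivation q σ δ d) (hq : q ≠ 0) (n : ℕ) (r : R) :
    d n (σ.symm r) = (q⁻¹) ^ n • σ.symm (d n r) := by
  have h1 := h.skew n (σ.symm r)
  rw [AlgEquiv.apply_symm_apply] at h1
  rw [h1, map_smul, AlgEquiv.symm_apply_apply, smul_smul, ← mul_pow, inv_mul_cancel₀ hq, one_pow,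
    one_smul]

theorem map_symm_iterate (h : IsHigherSkewDerivation q σ δ d) (hq : q ≠ 0) (n : ℕ) (r : R) :
    ∀ k : ℕ, d n (σ.symm^[k] r) = (q⁻¹) ^ (n * k) • σ.symm^[k] (d n r)
  | 0 => by simp
  | k + 1 => by
    rw [Function.iterate_succ_apply', h.map_symm hq, map_symm_iterate h hq n r k, map_smul,
      smul_smul, ← pow_add, Function.iterate_succ_apply']
    congr 2
    ring

end IsHigherSkewDerivation

/-- The operator `q^{n(n+1)/2} d_n σ^{-n}`. -/
def twistedOperator {K R : Type*} [Field K] [Ring R] [Algebra K R] (q : K) (σ : R ≃ₐ[K] R)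
    (d : ℕ → R →ₗ[K] R) (n : ℕ) (r : R) : R :=
  q ^ (n * (n + 1) / 2) • d n (σ.symm^[n] r)

section twistedOperator

variable {K R : Type*} [Field K] [Ring R] [Algebra K R] {q : K} {σ : R ≃ₐ[K] R}
  {δ : R →ₗ[K] R} {d : ℕ → R →ₗ[K] R}

theorem iterate_algEquiv_add (σ : R ≃ₐ[K] R) (n : ℕ) (r s : R) :
    σ^[n] (r + s) = σ^[n] r + σ^[n] s := by
  induction n with
  | zero => rfl
  | succ n ih => simp only [Function.iterate_succ_apply', ih, map_add]

theorem iterate_algEquiv_mul (σ : R ≃ₐ[K] R) (n : ℕ) (r s : R) :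
    σ^[n] (r * s) = σ^[n] r * σ^[n] s := by
  induction n with
  | zero => rfl
  | succ n ih => simp only [Function.iterate_succ_apply', ih, map_mul]

theorem iterate_algEquiv_smul (σ : R ≃ₐ[K] R) (n : ℕ) (c : K) (r : R) :
    σ^[n] (c • r) = c • σ^[n] r := by
  induction n with
  | zero => rfl
  | succ n ih => simp only [Function.iterate_succ_apply', ih, map_smul]

theorem iterate_algEquiv_zero (σ : R ≃ₐ[K] R) (n : ℕ) : σ^[n] (0 : R) = 0 := by
  induction n with
  | zero => rfl
  | succ n ih => rw [Function.iterate_succ_apply', ih, map_zero]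

theorem twistedOperator_zero (h : IsHigherSkewDerivation q σ δ d) (r : R) :
    twistedOperator q σ d 0 r = r := by
  simp [twistedOperator, h.zero]

theorem twistedOperator_add (n : ℕ) (r s : R) :
    twistedOperator q σ d n (r + s) = twistedOperator q σ d n r + twistedOperator q σ d n s := by
  simp only [twistedOperator, iterate_algEquiv_add, map_add, smul_add]

theorem twistedOperator_smul (n : ℕ) (c : K) (r : R) :
    twistedOperator q σ d n (c • r) = c • twistedOperator q σ d n r := by
  simp only [twistedOperator, iterate_algEquiv_smul, map_smul, smul_smul, mul_comm]

theorem twistedOperator_eq_zero (h : IsHigherSkewDerivation q σ δ d) (hq : q ≠ 0) {n : ℕ} {r : R}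
    (hr : d n r = 0) : twistedOperator q σ d n r = 0 := by
  rw [twistedOperator, h.map_symm_iterate hq, hr, iterate_algEquiv_zero, smul_zero, smul_zero]

theorem triangle_add (i k : ℕ) :
    (i + k) * (i + k + 1) / 2 = i * (i + 1) / 2 + k * (k + 1) / 2 + i * k := by
  have hi := Nat.even_mul_succ_self i
  have hk := Nat.even_mul_succ_self k
  have hik := Nat.even_mul_succ_self (i + k)
  obtain ⟨a, ha⟩ := hi
  obtain ⟨b, hb⟩ := hk
  have h : (i + k) * (i + k + 1) = 2 * (a + b + i * k) := by
    have : (i + k) * (i + k + 1) = i * (i + 1) + k * (k + 1) + 2 * (i * k) := by ring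
    rw [this, ha, hb]
    ring
  rw [ha, hb, h]
  omega

/-- Conjugating d_i by σ^k costs q^{-ik}. The exponents n(n+1)/2 fail to be additive by exactly ik
(`triangle_add`), so no power of q survives. -/
theorem twistedOperator_mul (h : IsHigherSkewDerivation q σ δ d) (hq : q ≠ 0) (n : ℕ) (r s : R) :
    twistedOperator q σ d n (r * s) = ∑ i ∈ Finset.range (n + 1),
      twistedOperator q σ d i r * twistedOperator q σ d (n - i) (σ.symm^[i] s) := by
  rw [twistedOperator, iterate_algEquiv_mul, h.mul, Finset.smul_sum]
  refine Finset.sum_congr rfl fun i hi => ?_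
  obtain ⟨k, rfl⟩ := Nat.exists_eq_add_of_le (Nat.lt_succ_iff.1 (Finset.mem_range.1 hi))
  have hcancel : ∀ a : R, σ^[k] (σ.symm^[k] a) = a := fun a =>
    (Function.LeftInverse.iterate (f := σ.symm) (g := σ) σ.apply_symm_apply k) a
  have h1 : σ^[k] (d i (σ.symm^[i + k] r)) = (q⁻¹) ^ (i * k) • d i (σ.symm^[i] r) := by
    rw [add_comm i k, Function.iterate_add_apply, h.map_symm_iterate hq i (σ.symm^[i] r) k,
      iterate_algEquiv_smul, hcancel]
  have h2 : σ.symm^[i + k] s = σ.symm^[k] (σ.symm^[i] s) := by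
    rw [add_comm i k, Function.iterate_add_apply]
  rw [Nat.add_sub_cancel_left, h1, h2, twistedOperator, twistedOperator, smul_mul_smul_comm,
    smul_mul_assoc, smul_smul]
  congr 1
  rw [triangle_add, pow_add, pow_add, mul_assoc, ← mul_pow, mul_inv_cancel₀ hq, one_pow, mul_one]

/-- Moving σ across d_{n+1} changes the coefficient by a factor q^{-(n+1)}. Up to a power of q the
defect is q^{n+1} - 1 = (q-1)(1 + ... + q^n), and iterativity turns it into δ d_n. -/
theorem twistedOperator_map (h : IsHigherSkewDerivation q σ δ d) (hq : q ≠ 0)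
    (hd : IsIterativeSeq q d) (n : ℕ) (r : R) :
    twistedOperator q σ d (n + 1) (σ r) =
      σ (twistedOperator q σ d (n + 1) r) + (q - 1) • δ (twistedOperator q σ d n r) := by
  have h1 : σ (d (n + 1) (σ.symm^[n + 1] r)) = (q⁻¹) ^ (n + 1) • d (n + 1) (σ.symm^[n] r) := by
    rw [Function.iterate_succ_apply', h.map_symm hq, map_smul, AlgEquiv.apply_symm_apply]
  have h2 : σ.symm^[n + 1] (σ r) = σ.symm^[n] r := by
    rw [Function.iterate_succ_apply, AlgEquiv.symm_apply_apply]
  simp only [twistedOperator, map_smul]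
  rw [h1, h2, ← h.one, hd, smul_smul, smul_smul, smul_smul, add_comm 1 n, ← add_smul]
  congr 1
  have h3 : (q - 1) * q ^ (n * (n + 1) / 2) * gaussBinom q (n + 1) n =
      q ^ (n * (n + 1) / 2) * (q ^ (n + 1) - 1) := by
    rw [← sub_one_mul_gaussBinom_succ_self]
    ring
  rw [h3, triangle_add, pow_add, pow_add, mul_assoc, ← pow_add, mul_one,
    show 1 * (1 + 1) / 2 + n = n + 1 by omega, mul_assoc, ← mul_pow, mul_inv_cancel₀ hq, one_pow]
  ring

end twistedOperator

/-! ### The deleting derivations homomorphism -/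

namespace OreRelations

variable {K R F : Type*} [Field K] [Ring R] [Algebra K R] [DivisionRing F] [Algebra K F] {q : K}
  {σ : R ≃ₐ[K] R} {δ : R →ₗ[K] R} {d : ℕ → R →ₗ[K] R} {φ : R →ₐ[K] F} {x : F}

/-- The inverse of `(q - 1) x`. -/
def scaledInv (q : K) (x : F) : F := (q - 1)⁻¹ • x⁻¹

theorem scaledInv_pow (q : K) (x : F) (n : ℕ) :
    scaledInv q x ^ n = ((q - 1) ^ n)⁻¹ • (x ^ n)⁻¹ := by
  rw [scaledInv, smul_pow, inv_pow, inv_pow]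

/-- The image of `r` under the deleting derivations homomorphism. -/
noncomputable def deleteFun (q : K) (σ : R ≃ₐ[K] R) (d : ℕ → R →ₗ[K] R) (φ : R →ₐ[K] F) (x : F)
    (r : R) : F :=
  ∑ᶠ n : ℕ, ((q ^ (n * (n + 1) / 2)) * ((q - 1) ^ n)⁻¹) •
    (φ (d n (σ.symm^[n] r)) * (x ^ n)⁻¹)

variable (H : OreRelations q σ δ d φ x)
include H

theorem deleteFun_eq_sum {r : R} {m : ℕ} (hm : ∀ n, m ≤ n → d n r = 0) :
    deleteFun q σ d φ x r =
      ∑ n ∈ Finset.range m, φ (twistedOperator q σ d n r) * scaledInv q x ^ n := by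
  have hterm : ∀ n : ℕ, ((q ^ (n * (n + 1) / 2)) * ((q - 1) ^ n)⁻¹) •
      (φ (d n (σ.symm^[n] r)) * (x ^ n)⁻¹) =
        φ (twistedOperator q σ d n r) * scaledInv q x ^ n := by
    intro n
    rw [scaledInv_pow, twistedOperator, map_smul, smul_mul_smul_comm]
  rw [deleteFun, finsum_congr hterm]
  refine finsum_eq_sum_of_support_subset _ fun n hn => ?_
  by_contra hn'
  have : m ≤ n := by simpa using hn'
  refine hn ?_
  beta_reduce
  rw [twistedOperator_eq_zero H.higher H.q_ne_zero (hm n this), map_zero, zero_mul]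

theorem apply_symm_iterate_eq_zero {r : R} {m : ℕ} (hm : ∀ n, m ≤ n → d n r = 0) (k : ℕ) :
    ∀ n, m ≤ n → d n (σ.symm^[k] r) = 0 := by
  intro n hn
  rw [H.higher.map_symm_iterate H.q_ne_zero, hm n hn, iterate_algEquiv_zero, smul_zero]

theorem apply_apply_eq_zero {r : R} {m : ℕ} (hm : ∀ n, m + 1 ≤ n → d n r = 0) (k : ℕ) :
    ∀ n, m ≤ n → d n (d (k + 1) r) = 0 := by
  intro n hn
  rw [H.iterative, hm _ (by omega), smul_zero]

theorem scaledInv_mul_x : scaledInv q x * x = algebraMap K F (q - 1)⁻¹ := by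
  rw [scaledInv, smul_mul_assoc, inv_mul_cancel₀ H.x_ne_zero, Algebra.algebraMap_eq_smul_one]

theorem smul_x_mul_scaledInv : ((q - 1) • x) * scaledInv q x = 1 := by
  have : q - 1 ≠ 0 := sub_ne_zero.2 H.q_ne_one
  rw [scaledInv, smul_mul_smul_comm, mul_inv_cancel₀ this, mul_inv_cancel₀ H.x_ne_zero, one_smul]

theorem scaledInv_mul_smul_x : scaledInv q x * ((q - 1) • x) = 1 := by
  have : q - 1 ≠ 0 := sub_ne_zero.2 H.q_ne_one
  rw [scaledInv, smul_mul_smul_comm, inv_mul_cancel₀ this, inv_mul_cancel₀ H.x_ne_zero, one_smul]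

/-- Under conjugation by (q-1)x the Ore relation splits the term of degree n into a σ-term of degree
n and a δ-term of degree n+1. By `twistedOperator_map` the terms of equal degree add up to those of
the series of σ r. -/
theorem smul_x_mul_deleteFun (r : R) :
    ((q - 1) • x) * deleteFun q σ d φ x r * scaledInv q x = deleteFun q σ d φ x (σ r) := by
  obtain ⟨m, hm⟩ := H.nilpotent r
  have hm' : ∀ n, m + 1 ≤ n → d n (σ r) = 0 := fun n hn => by
    rw [H.higher.skew, hm n (by omega), map_zero, smul_zero]
  rw [H.deleteFun_eq_sum hm, H.deleteFun_eq_sum hm', Finset.sum_range_succ',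
    twistedOperator_zero H.higher, pow_zero, mul_one, Finset.mul_sum, Finset.sum_mul]
  have hterm : ∀ n : ℕ, ((q - 1) • x) * (φ (twistedOperator q σ d n r) * scaledInv q x ^ n) *
      scaledInv q x = φ (σ (twistedOperator q σ d n r)) * scaledInv q x ^ n +
        φ ((q - 1) • δ (twistedOperator q σ d n r)) * scaledInv q x ^ (n + 1) := by
    intro n
    have h1 : ((q - 1) • x) * φ (twistedOperator q σ d n r) =
        φ (σ (twistedOperator q σ d n r)) * ((q - 1) • x) +
          φ ((q - 1) • δ (twistedOperator q σ d n r)) := by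
      rw [smul_mul_assoc, H.comm, smul_add, map_smul, mul_smul_comm]
    have h2 : ((q - 1) • x) * scaledInv q x ^ (n + 1) = scaledInv q x ^ n := by
      rw [pow_succ', ← mul_assoc, H.smul_x_mul_scaledInv, one_mul]
    rw [mul_assoc, mul_assoc, ← pow_succ, ← mul_assoc, h1, add_mul, mul_assoc, h2]
  simp only [hterm, twistedOperator_map H.higher H.q_ne_zero H.iterative, map_add, add_mul,
    Finset.sum_add_distrib]
  -- The σ-terms have degrees 0, ..., m-1 on one side and 0, ..., m on the other; the extra one
  -- vanishes.
  have hm0 : φ (σ (twistedOperator q σ d m r)) * scaledInv q x ^ m = 0 := by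
    rw [twistedOperator_eq_zero H.higher H.q_ne_zero (hm m le_rfl), map_zero, map_zero, zero_mul]
  have hshift := Finset.sum_range_succ'
    (fun n => φ (σ (twistedOperator q σ d n r)) * scaledInv q x ^ n) m
  rw [Finset.sum_range_succ, hm0, add_zero, twistedOperator_zero H.higher, pow_zero,
    mul_one] at hshift
  rw [hshift]
  abel

theorem x_mul_deleteFun (r : R) :
    x * deleteFun q σ d φ x r = deleteFun q σ d φ x (σ r) * x := by
  have hq : q - 1 ≠ 0 := sub_ne_zero.2 H.q_ne_one
  have h := H.smul_x_mul_deleteFun r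
  rw [← h, mul_assoc _ (scaledInv q x) x, H.scaledInv_mul_x, ← Algebra.commutes, ← Algebra.smul_def,
    smul_mul_assoc, smul_smul, inv_mul_cancel₀ hq, one_smul]

theorem scaledInv_pow_mul_deleteFun (k : ℕ) (r : R) :
    scaledInv q x ^ k * deleteFun q σ d φ x r =
      deleteFun q σ d φ x (σ.symm^[k] r) * scaledInv q x ^ k := by
  induction k with
  | zero => simp
  | succ k ih =>
    have h := H.smul_x_mul_deleteFun (σ.symm (σ.symm^[k] r))
    rw [AlgEquiv.apply_symm_apply] at h
    rw [pow_succ', mul_assoc, ih, ← h, Function.iterate_succ_apply', ← mul_assoc, ← mul_assoc,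
      ← mul_assoc, H.scaledInv_mul_smul_x, one_mul, mul_assoc]

/-- In the double sum given by `twistedOperator_mul`, the inner sum for fixed i is θ(σ^{-i} s).
Since θ(σ^{-i} s) y^i = y^i θ(s), the factor θ(s) comes out on the right and the sum over i is θ(r).
-/
theorem deleteFun_mul (r s : R) : deleteFun q σ d φ x (r * s) =
    deleteFun q σ d φ x r * deleteFun q σ d φ x s := by
  obtain ⟨m, hm⟩ := H.nilpotent r
  obtain ⟨m', hm'⟩ := H.nilpotent s
  obtain ⟨M, hM⟩ := H.nilpotent (r * s)
  -- With this cut-off the inner sum, shortened by i, still covers the series of s whenever i < m;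
  -- for i ≥ m the factor from r is zero.
  have hlarge : ∀ n, m + m' + M ≤ n → d n (r * s) = 0 := fun n hn => hM n (by omega)
  have hm2 : ∀ n, m + m' + M ≤ n → d n r = 0 := fun n hn => hm n (by omega)
  rw [H.deleteFun_eq_sum hlarge, H.deleteFun_eq_sum hm2, Finset.sum_mul]
  have hterm : ∀ n : ℕ, φ (twistedOperator q σ d n (r * s)) * scaledInv q x ^ n =
      ∑ i ∈ Finset.range (n + 1), φ (twistedOperator q σ d i r) *
        (φ (twistedOperator q σ d (n - i) (σ.symm^[i] s)) * scaledInv q x ^ (n - i)) *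
          scaledInv q x ^ i := by
    intro n
    rw [twistedOperator_mul H.higher H.q_ne_zero, map_sum, Finset.sum_mul]
    refine Finset.sum_congr rfl fun i hi => ?_
    have hi' : n - i + i = n := Nat.sub_add_cancel (Nat.lt_succ_iff.1 (Finset.mem_range.1 hi))
    rw [map_mul, mul_assoc, mul_assoc, mul_assoc, ← pow_add, hi']
  simp only [hterm]
  rw [Finset.sum_range_diag_flip (m + m' + M) fun i k => φ (twistedOperator q σ d i r) *
        (φ (twistedOperator q σ d k (σ.symm^[i] s)) * scaledInv q x ^ k) * scaledInv q x ^ i]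
  refine Finset.sum_congr rfl fun i _ => ?_
  rw [← Finset.sum_mul, ← Finset.mul_sum, mul_assoc (φ _) (scaledInv q x ^ i),
    H.scaledInv_pow_mul_deleteFun]
  by_cases hi : i < m
  · rw [← mul_assoc, H.deleteFun_eq_sum (m := m + m' + M - i)
      (H.apply_symm_iterate_eq_zero (fun n hn => hm' n (by omega)) i)]
  · rw [twistedOperator_eq_zero H.higher H.q_ne_zero (hm i (not_lt.1 hi))]
    simp

theorem deleteFun_add (r s : R) : deleteFun q σ d φ x (r + s) =
    deleteFun q σ d φ x r + deleteFun q σ d φ x s := by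
  obtain ⟨m, hm⟩ := H.nilpotent r
  obtain ⟨m', hm'⟩ := H.nilpotent s
  rw [H.deleteFun_eq_sum (m := m + m') (r := r + s) fun n hn => by
      rw [map_add, hm n (by omega), hm' n (by omega), add_zero],
    H.deleteFun_eq_sum (m := m + m') (r := r) fun n hn => hm n (by omega),
    H.deleteFun_eq_sum (m := m + m') (r := s) fun n hn => hm' n (by omega),
    ← Finset.sum_add_distrib]
  exact Finset.sum_congr rfl fun n _ => by rw [twistedOperator_add, map_add, add_mul]

theorem deleteFun_smul (c : K) (r : R) : deleteFun q σ d φ x (c • r) =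
    c • deleteFun q σ d φ x r := by
  obtain ⟨m, hm⟩ := H.nilpotent r
  rw [H.deleteFun_eq_sum (m := m) (r := c • r) fun n hn => by rw [map_smul, hm n hn, smul_zero],
    H.deleteFun_eq_sum hm, Finset.smul_sum]
  exact Finset.sum_congr rfl fun n _ => by rw [twistedOperator_smul, map_smul, smul_mul_assoc]

/-- By induction the Leibniz rule for 1 · 1 keeps only its two end terms, so d_n(1) = d_n(1) +
d_n(1). -/
theorem apply_one (n : ℕ) (hn : 1 ≤ n) : d n (1 : R) = 0 := by
  induction n using Nat.strong_induction_on with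
  | _ n ih =>
    have h := H.higher.mul n 1 1
    have hone : ∀ k, σ^[k] (1 : R) = 1 := fun k => by
      induction k with
      | zero => rfl
      | succ k ih => rw [Function.iterate_succ_apply', ih, map_one]
    obtain ⟨k, rfl⟩ := Nat.exists_eq_add_of_le' hn
    rw [Finset.sum_range_succ', Finset.sum_range_succ, Finset.sum_eq_zero] at h
    · simp [H.higher.zero, hone] at h
      exact h
    · intro i hi
      rw [ih (i + 1) (by have := Finset.mem_range.1 hi; omega) (by omega),
        iterate_algEquiv_zero, zero_mul]

theorem deleteFun_one : deleteFun q σ d φ x 1 = 1 := by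
  rw [H.deleteFun_eq_sum (m := 1) H.apply_one, Finset.sum_range_one,
    twistedOperator_zero H.higher, map_one, pow_zero, one_mul]

omit H in
/-- The deleting derivations homomorphism. -/
noncomputable def deleteHom (H : OreRelations q σ δ d φ x) : R →ₐ[K] F :=
  AlgHom.ofLinearMap
    { toFun := deleteFun q σ d φ x
      map_add' := H.deleteFun_add
      map_smul' := H.deleteFun_smul } H.deleteFun_one H.deleteFun_mul

theorem deleteHom_apply (r : R) : H.deleteHom r = deleteFun q σ d φ x r := rfl

theorem x_mul_deleteHom (r : R) : x * H.deleteHom r = H.deleteHom (σ r) * x :=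
  H.x_mul_deleteFun r

end OreRelations

/-! ### Ore localization at the powers of one element -/

/-- Every fraction `x⁻ⁿ b` with `b` in `B` is of the form `b' x⁻ᵐ` with `b'` in `B`. -/
def IsOreElement {K F : Type*} [Field K] [DivisionRing F] [Algebra K F] (B : Subalgebra K F)
    (x : F) : Prop :=
  ∀ b ∈ B, ∀ n : ℕ, ∃ m : ℕ, (x ^ n)⁻¹ * b * x ^ m ∈ B

section IsOreElement

variable {K F : Type*} [Field K] [DivisionRing F] [Algebra K F]

/-- For a product, the exponent found for the first factor becomes the denominator of the second;
for a sum, both exponents are raised to their sum. Hence generators suffice. -/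
theorem isOreElement_adjoin {S : Set F} {x : F} (hx0 : x ≠ 0) (hx : x ∈ Algebra.adjoin K S)
    (h : ∀ s ∈ S, ∀ n : ℕ, ∃ m : ℕ, (x ^ n)⁻¹ * s * x ^ m ∈ Algebra.adjoin K S) :
    IsOreElement (Algebra.adjoin K S) x := by
  intro b hb
  induction hb using Algebra.adjoin_induction with
  | mem s hs => exact h s hs
  | algebraMap c =>
    intro n
    refine ⟨n, ?_⟩
    rw [← Algebra.commutes, mul_assoc, inv_mul_cancel₀ (pow_ne_zero n hx0), mul_one]
    exact Subalgebra.algebraMap_mem _ c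
  | add a b _ _ iha ihb =>
    intro n
    obtain ⟨m, hm⟩ := iha n
    obtain ⟨k, hk⟩ := ihb n
    refine ⟨m + k, ?_⟩
    have h1 := mul_mem hm (pow_mem hx k)
    have h2 := mul_mem hk (pow_mem hx m)
    rw [mul_assoc, ← pow_add] at h1 h2
    rw [add_comm k m] at h2
    rw [mul_add, add_mul]
    exact add_mem h1 h2
  | mul a b _ _ iha ihb =>
    intro n
    obtain ⟨m, hm⟩ := iha n
    obtain ⟨k, hk⟩ := ihb m
    refine ⟨k, ?_⟩
    have h1 := mul_mem hm hk
    have h2 : x ^ m * ((x ^ m)⁻¹ * b * x ^ k) = b * x ^ k := by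
      rw [← mul_assoc, ← mul_assoc, mul_inv_cancel₀ (pow_ne_zero m hx0), one_mul]
    rw [mul_assoc, h2] at h1
    simpa only [mul_assoc] using h1

/-- The algebra of fractions `b x⁻ⁿ` with `b` in `B`. -/
def fractionAlgebra (B : Subalgebra K F) {x : F} (hx : x ∈ B) (hx0 : x ≠ 0)
    (hO : IsOreElement B x) : Subalgebra K F where
  carrier := {z | ∃ n : ℕ, z * x ^ n ∈ B}
  mul_mem' := by
    rintro z w ⟨n, hn⟩ ⟨m, hm⟩
    obtain ⟨k, hk⟩ := hO _ hm n
    refine ⟨m + k, ?_⟩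
    have h1 := mul_mem hn hk
    have h2 : x ^ n * ((x ^ n)⁻¹ * (w * x ^ m) * x ^ k) = w * x ^ (m + k) := by
      rw [← mul_assoc, ← mul_assoc, mul_inv_cancel₀ (pow_ne_zero n hx0), one_mul, pow_add,
        mul_assoc]
    rw [mul_assoc, h2] at h1
    rwa [mul_assoc]
  add_mem' := by
    rintro z w ⟨n, hn⟩ ⟨m, hm⟩
    refine ⟨n + m, ?_⟩
    have h1 := mul_mem hn (pow_mem hx m)
    have h2 := mul_mem hm (pow_mem hx n)
    rw [mul_assoc, ← pow_add] at h1 h2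
    rw [add_comm m n] at h2
    rw [add_mul]
    exact add_mem h1 h2
  algebraMap_mem' := fun c => ⟨0, by simp⟩

theorem le_fractionAlgebra {B : Subalgebra K F} {x : F} {hx : x ∈ B} {hx0 : x ≠ 0}
    {hO : IsOreElement B x} : B ≤ fractionAlgebra B hx hx0 hO :=
  fun z hz => ⟨0, by simpa using hz⟩

theorem inv_mem_fractionAlgebra {B : Subalgebra K F} {x : F} {hx : x ∈ B} {hx0 : x ≠ 0}
    {hO : IsOreElement B x} : x⁻¹ ∈ fractionAlgebra B hx hx0 hO :=
  ⟨1, by simp [hx0]⟩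

end IsOreElement

/-- The subalgebras `B` and `C` contain `x`, satisfy the right Ore condition for the powers of `x`,
and have the same localization at `x`. -/
structure SameFractions {K F : Type*} [Field K] [DivisionRing F] [Algebra K F]
    (B C : Subalgebra K F) (x : F) : Prop where
  ne_zero : x ≠ 0
  mem_left : x ∈ B
  mem_right : x ∈ C
  ore_left : IsOreElement B x
  ore_right : IsOreElement C x
  left_le : ∀ b ∈ B, ∃ n : ℕ, b * x ^ n ∈ C
  right_le : ∀ c ∈ C, ∃ n : ℕ, c * x ^ n ∈ B

theorem SameFractions.symm {K F : Type*} [Field K] [DivisionRing F] [Algebra K F]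
    {B C : Subalgebra K F} {x : F} (h : SameFractions B C x) : SameFractions C B x :=
  ⟨h.ne_zero, h.mem_right, h.mem_left, h.ore_right, h.ore_left, h.right_le, h.left_le⟩

/-! ### Completely prime ideals under localization and quotients -/

namespace CSpec

theorem ext_mem {R : Type*} [Ring R] {P Q : CSpec R} (h : ∀ a, a ∈ P.1 ↔ a ∈ Q.1) : P = Q :=
  Subtype.ext (TwoSidedIdeal.ext h)

theorem one_notMem {R : Type*} [Ring R] (P : CSpec R) : (1 : R) ∉ P.1 := by
  intro h
  refine P.2.1 (top_le_iff.1 fun a _ => ?_)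
  simpa using P.1.mul_mem_left a 1 h

theorem mem_of_mul_pow_mem {R : Type*} [Ring R] (P : CSpec R) {x : R} (hx : x ∉ P.1) {a : R} :
    ∀ {n : ℕ}, a * x ^ n ∈ P.1 → a ∈ P.1
  | 0, h => by simpa using h
  | n + 1, h => by
    rw [pow_succ, ← mul_assoc] at h
    exact mem_of_mul_pow_mem P hx ((P.2.2 _ _ h).resolve_right hx)

theorem mem_of_pow_mul_mem {R : Type*} [Ring R] (P : CSpec R) {x : R} (hx : x ∉ P.1) {a : R} :
    ∀ {n : ℕ}, x ^ n * a ∈ P.1 → a ∈ P.1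
  | 0, h => by simpa using h
  | n + 1, h => by
    rw [pow_succ', mul_assoc] at h
    exact mem_of_pow_mul_mem P hx ((P.2.2 _ _ h).resolve_left hx)

section Fractions

variable {K F : Type*} [Field K] [DivisionRing F] [Algebra K F] {B : Subalgebra K F}

/-- The extension of `P` to the algebra of fractions with denominators the powers of `x`. -/
def fractionSet (P : CSpec B) (x : F) : Set F :=
  {z | ∃ n : ℕ, ∃ p ∈ P.1, z * x ^ n = (p : F)}

variable {x : F} (P : CSpec B) (hx : x ∈ B) (hx0 : x ≠ 0) (hO : IsOreElement B x)
  (hP : (⟨x, hx⟩ : B) ∉ P.1)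

include hP in
-- Complete primeness allows powers of x to be cancelled, so membership does not depend on the
-- fraction representing z.
theorem mem_fractionSet_iff {z : F} {n : ℕ} {b : B} (h : z * x ^ n = b) :
    z ∈ fractionSet P x ↔ b ∈ P.1 := by
  refine ⟨?_, fun hb => ⟨n, b, hb, h⟩⟩
  rintro ⟨m, p, hp, hm⟩
  refine mem_of_mul_pow_mem P hP (n := m) ?_
  have : b * (⟨x, hx⟩ : B) ^ m = p * (⟨x, hx⟩ : B) ^ n := by
    ext
    push_cast
    rw [← h, ← hm, mul_assoc, mul_assoc, ← pow_add, ← pow_add, add_comm]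
  rw [this]
  exact P.1.mul_mem_right _ _ hp

include hP in
theorem one_notMem_fractionSet : (1 : F) ∉ fractionSet P x := by
  rw [mem_fractionSet_iff P hx hP (n := 0) (b := 1) (by simp)]
  exact P.one_notMem

include hx in
theorem add_mem_fractionSet {z w : F} (hz : z ∈ fractionSet P x) (hw : w ∈ fractionSet P x) :
    z + w ∈ fractionSet P x := by
  obtain ⟨n, p, hp, hn⟩ := hz
  obtain ⟨m, r, hr, hm⟩ := hw
  refine ⟨n + m, p * ⟨x, hx⟩ ^ m + r * ⟨x, hx⟩ ^ n,
    P.1.add_mem (P.1.mul_mem_right _ _ hp) (P.1.mul_mem_right _ _ hr), ?_⟩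
  push_cast
  rw [← hn, ← hm, add_mul, mul_assoc, mul_assoc, ← pow_add, ← pow_add, add_comm m n]

theorem neg_mem_fractionSet {z : F} (hz : z ∈ fractionSet P x) : -z ∈ fractionSet P x := by
  obtain ⟨n, p, hp, hn⟩ := hz
  exact ⟨n, -p, P.1.neg_mem hp, by rw [neg_mul, hn]; rfl⟩

theorem zero_mem_fractionSet : (0 : F) ∈ fractionSet P x :=
  ⟨0, 0, P.1.zero_mem, by simp⟩

theorem exists_ore_fraction (hO : IsOreElement B x) (hx0 : x ≠ 0) (hx : x ∈ B) (b : B) (n : ℕ) :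
    ∃ (m : ℕ) (b' : B),
      b * (⟨x, hx⟩ : B) ^ m = (⟨x, hx⟩ : B) ^ n * b' ∧ (b' : F) = (x ^ n)⁻¹ * b * x ^ m := by
  obtain ⟨m, hm⟩ := hO b b.2 n
  refine ⟨m, ⟨_, hm⟩, ?_, rfl⟩
  ext
  push_cast
  rw [← mul_assoc, ← mul_assoc, mul_inv_cancel₀ (pow_ne_zero n hx0), one_mul]

theorem mul_mul_pow_eq {z w b b' c : F} (hx0 : x ≠ 0) {k n m : ℕ} (hw : w * x ^ k = b)
    (hz : z * x ^ n = b') (hc : c = (x ^ k)⁻¹ * b' * x ^ m) : w * z * x ^ (n + m) = b * c := by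
  rw [hc, ← hw, ← hz, pow_add]
  have : x ^ k * (x ^ k)⁻¹ = 1 := mul_inv_cancel₀ (pow_ne_zero k hx0)
  calc w * z * (x ^ n * x ^ m) = w * 1 * z * x ^ n * x ^ m := by simp only [mul_assoc, one_mul]
    _ = _ := by rw [← this]; simp only [mul_assoc]

include hx hx0 hO hP

/-- The numerator is moved past a denominator by the Ore condition, and stays in P because x^k b' ∈
P forces b' ∈ P. On the right only the cofactor is moved, so there primeness plays no role. -/
theorem mul_mem_fractionSet_left {z w : F} (hw : ∃ k : ℕ, w * x ^ k ∈ B)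
    (hz : z ∈ fractionSet P x) : w * z ∈ fractionSet P x := by
  obtain ⟨k, hk⟩ := hw
  obtain ⟨n, p, hp, hn⟩ := hz
  obtain ⟨m, b', h1, h2⟩ := exists_ore_fraction hO hx0 hx p k
  have hb' : b' ∈ P.1 := mem_of_pow_mul_mem P hP (n := k) (h1 ▸ P.1.mul_mem_right _ _ hp)
  exact ⟨n + m, ⟨_, hk⟩ * b', P.1.mul_mem_left _ _ hb', mul_mul_pow_eq hx0 rfl hn h2⟩

omit hP in
theorem mul_mem_fractionSet_right {z w : F} (hw : ∃ k : ℕ, w * x ^ k ∈ B)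
    (hz : z ∈ fractionSet P x) : z * w ∈ fractionSet P x := by
  obtain ⟨k, hk⟩ := hw
  obtain ⟨n, p, hp, hn⟩ := hz
  obtain ⟨m, b', -, h2⟩ := exists_ore_fraction hO hx0 hx ⟨_, hk⟩ n
  exact ⟨k + m, p * b', P.1.mul_mem_right _ _ hp, mul_mul_pow_eq hx0 hn rfl h2⟩

theorem mem_or_mem_of_mul_mem_fractionSet {z w : F} (hw : ∃ k : ℕ, w * x ^ k ∈ B)
    (hz : ∃ n : ℕ, z * x ^ n ∈ B) (h : w * z ∈ fractionSet P x) :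
    w ∈ fractionSet P x ∨ z ∈ fractionSet P x := by
  obtain ⟨k, hk⟩ := hw
  obtain ⟨n, hn⟩ := hz
  obtain ⟨m, b', h1, h2⟩ := exists_ore_fraction hO hx0 hx ⟨_, hn⟩ k
  rw [mem_fractionSet_iff P hx hP (b := ⟨_, hk⟩ * b')
    (mul_mul_pow_eq hx0 rfl rfl h2)] at h
  refine (P.2.2 _ _ h).imp (fun hb => ⟨k, _, hb, rfl⟩) fun hb => ⟨n, ⟨_, hn⟩, ?_, rfl⟩
  exact mem_of_mul_pow_mem P hP (n := m) (h1 ▸ P.1.mul_mem_left _ _ hb)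

end Fractions

section Transfer

variable {K F : Type*} [Field K] [DivisionRing F] [Algebra K F] {B C : Subalgebra K F} {x : F}

/-- The completely prime ideal `P S⁻¹ ∩ C` of `C`, where `S` consists of the powers of `x`. -/
def transfer (h : SameFractions B C x) (P : CSpec B) (hP : (⟨x, h.mem_left⟩ : B) ∉ P.1) :
    CSpec C :=
  ⟨TwoSidedIdeal.mk' {c : C | (c : F) ∈ fractionSet P x}
      (zero_mem_fractionSet P)
      (fun ha hb => add_mem_fractionSet P h.mem_left ha hb)
      (fun ha => neg_mem_fractionSet P ha)
      (fun {a _} hb => mul_mem_fractionSet_left P h.mem_left h.ne_zero h.ore_left hP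
        (h.right_le a a.2) hb)
      (fun {_ b} ha => mul_mem_fractionSet_right P h.mem_left h.ne_zero h.ore_left
        (h.right_le b b.2) ha), by
    constructor
    · intro htop
      have h1 : (1 : C) ∈ (⊤ : TwoSidedIdeal C) := trivial
      rw [← htop, TwoSidedIdeal.mem_mk'] at h1
      exact one_notMem_fractionSet P h.mem_left hP h1
    · intro a b hab
      rw [TwoSidedIdeal.mem_mk'] at hab ⊢
      rw [TwoSidedIdeal.mem_mk']
      exact mem_or_mem_of_mul_mem_fractionSet P h.mem_left h.ne_zero h.ore_left hP
        (h.right_le a a.2) (h.right_le b b.2) hab⟩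

theorem mem_transfer (h : SameFractions B C x) (P : CSpec B)
    (hP : (⟨x, h.mem_left⟩ : B) ∉ P.1) (c : C) :
    c ∈ (transfer h P hP).1 ↔ (c : F) ∈ fractionSet P x := by
  rw [transfer, TwoSidedIdeal.mem_mk']
  rfl

theorem notMem_transfer (h : SameFractions B C x) (P : CSpec B)
    (hP : (⟨x, h.mem_left⟩ : B) ∉ P.1) : (⟨x, h.mem_right⟩ : C) ∉ (transfer h P hP).1 := by
  rw [mem_transfer, mem_fractionSet_iff P h.mem_left hP (n := 0) (b := ⟨x, h.mem_left⟩) (by simp)]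
  exact hP

/-- Because `SameFractions` is symmetric, this one identity yields both injectivity and, through
`h.symm`, surjectivity. -/
theorem transfer_transfer (h : SameFractions B C x) (P : CSpec B)
    (hP : (⟨x, h.mem_left⟩ : B) ∉ P.1) :
    transfer h.symm (transfer h P hP) (notMem_transfer h P hP) = P := by
  refine ext_mem fun b => ?_
  rw [mem_transfer]
  obtain ⟨n, hn⟩ := h.left_le b b.2
  rw [mem_fractionSet_iff _ h.mem_right (notMem_transfer h P hP) (n := n) (b := ⟨_, hn⟩) rfl,
    mem_transfer, mem_fractionSet_iff P h.mem_left hP (n := 0) (b := b * ⟨x, h.mem_left⟩ ^ n)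
      (by simp)]
  exact ⟨mem_of_mul_pow_mem P hP, P.1.mul_mem_right _ _⟩

theorem mem_fractionSet_iff_eq_mul_inv (P : CSpec B) (hx0 : x ≠ 0) (z : F) :
    z ∈ fractionSet P x ↔ ∃ p ∈ P.1, ∃ n : ℕ, z = (p : F) * (x ^ n)⁻¹ := by
  constructor
  · rintro ⟨n, p, hp, h⟩
    exact ⟨p, hp, n, by rw [← h, mul_assoc, mul_inv_cancel₀ (pow_ne_zero n hx0), mul_one]⟩
  · rintro ⟨p, hp, n, h⟩
    exact ⟨n, p, hp, by rw [h, mul_assoc, inv_mul_cancel₀ (pow_ne_zero n hx0), mul_one]⟩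

end Transfer

section Comap

variable {R S T : Type*} [Ring R] [Ring S] [Ring T]

/-- For `g : S → T` and a surjective `π : R → T` whose kernel lies in `P`, the ideal
`g⁻¹(π(P))`. -/
def pullback (π : R →+* T) (hπ : Function.Surjective π) (g : S →+* T) (P : CSpec R)
    (hP : ∀ a, π a = 0 → a ∈ P.1) : CSpec S :=
  ⟨TwoSidedIdeal.mk' {s : S | ∃ p ∈ P.1, π p = g s}
      ⟨0, P.1.zero_mem, by simp⟩
      (by
        rintro a b ⟨p, hp, h⟩ ⟨r, hr, h'⟩
        exact ⟨p + r, P.1.add_mem hp hr, by simp [h, h']⟩)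
      (by
        rintro a ⟨p, hp, h⟩
        exact ⟨-p, P.1.neg_mem hp, by simp [h]⟩)
      (by
        rintro a b ⟨p, hp, h⟩
        obtain ⟨r, hr⟩ := hπ (g a)
        exact ⟨r * p, P.1.mul_mem_left _ _ hp, by simp [h, hr]⟩)
      (by
        rintro a b ⟨p, hp, h⟩
        obtain ⟨r, hr⟩ := hπ (g b)
        exact ⟨p * r, P.1.mul_mem_right _ _ hp, by simp [h, hr]⟩), by
    have key : ∀ a p, p ∈ P.1 → π p = π a → a ∈ P.1 := fun a p hp h => by
      have := P.1.add_mem (hP (a - p) (by simp [h])) hp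
      simpa using this
    constructor
    · intro htop
      have h1 : (1 : S) ∈ (⊤ : TwoSidedIdeal S) := trivial
      rw [← htop, TwoSidedIdeal.mem_mk'] at h1
      obtain ⟨p, hp, h⟩ := h1
      exact P.one_notMem (key 1 p hp (by simp [h]))
    · intro a b hab
      rw [TwoSidedIdeal.mem_mk'] at hab ⊢
      rw [TwoSidedIdeal.mem_mk']
      obtain ⟨p, hp, h⟩ := hab
      obtain ⟨r, hr⟩ := hπ (g a)
      obtain ⟨s, hs⟩ := hπ (g b)
      exact (P.2.2 r s (key _ p hp (by simp [h, hr, hs]))).imp (fun h => ⟨r, h, hr⟩)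
        fun h => ⟨s, h, hs⟩⟩

theorem mem_pullback (π : R →+* T) (hπ : Function.Surjective π) (g : S →+* T) (P : CSpec R)
    (hP : ∀ a, π a = 0 → a ∈ P.1) (s : S) :
    s ∈ (pullback π hπ g P hP).1 ↔ ∃ p ∈ P.1, π p = g s := by
  rw [pullback, TwoSidedIdeal.mem_mk']
  rfl

/-- Two lifts of the same class differ by an element of ker π, which lies in P; any lift can
therefore be tested. -/
theorem mem_pullback_iff (π : R →+* T) (hπ : Function.Surjective π) (g : S →+* T) (P : CSpec R)
    (hP : ∀ a, π a = 0 → a ∈ P.1) {r : R} {s : S} (h : π r = g s) :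
    s ∈ (pullback π hπ g P hP).1 ↔ r ∈ P.1 := by
  rw [mem_pullback]
  refine ⟨?_, fun hr => ⟨r, hr, h⟩⟩
  rintro ⟨p, hp, h'⟩
  have := P.1.add_mem (hP (r - p) (by simp [h, h'])) hp
  simpa using this

end Comap

end CSpec

/-! ### Leading terms, denominators and inversion of the series -/

/-- The powers of `y` are left linearly independent over `V`. -/
def LeftIndependentPowers {K F : Type*} [Field K] [DivisionRing F] [Algebra K F]
    (V : Subalgebra K F) (y : F) : Prop :=
  ∀ (M : ℕ) (p : ℕ → F), (∀ n < M, p n ∈ V) → ∑ n ∈ Finset.range M, p n * y ^ n = 0 →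
    ∀ n < M, p n = 0

namespace OreRelations

variable {K R F : Type*} [Field K] [Ring R] [Algebra K R] [DivisionRing F] [Algebra K F] {q : K}
  {σ : R ≃ₐ[K] R} {δ : R →ₗ[K] R} {d : ℕ → R →ₗ[K] R} {φ : R →ₐ[K] F} {x : F}

/-- The elements `∑_{n ≥ 1} φ(a_n) x⁻ⁿ`. -/
def lowerTerms (φ : R →ₐ[K] F) (x : F) : Submodule K F :=
  Submodule.span K {z | ∃ (a : R) (n : ℕ), z = φ a * (x ^ (n + 1))⁻¹}

/-- The strict bound on the degree after clearing denominators is what separates these elements from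
the image of φ. -/
theorem exists_of_mem_lowerTerms (hx : x ≠ 0) {z : F} (hz : z ∈ lowerTerms φ x) :
    ∃ (k : ℕ) (a : ℕ → R), z * x ^ k = ∑ i ∈ Finset.range k, φ (a i) * x ^ i := by
  have hraise : ∀ {w : F} {k : ℕ} {a : ℕ → R},
      w * x ^ k = ∑ i ∈ Finset.range k, φ (a i) * x ^ i → ∀ m, ∃ b : ℕ → R,
        w * x ^ (k + m) = ∑ i ∈ Finset.range (k + m), φ (b i) * x ^ i := by
    intro w k a h m
    induction m with
    | zero => exact ⟨a, h⟩
    | succ m ih =>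
      obtain ⟨b, hb⟩ := ih
      refine ⟨fun i => if i = 0 then 0 else b (i - 1), ?_⟩
      rw [← add_assoc, Finset.sum_range_succ', pow_succ, ← mul_assoc, hb, Finset.sum_mul]
      simp [pow_succ, mul_assoc]
  induction hz using Submodule.span_induction with
  | mem z hz =>
    obtain ⟨a, n, rfl⟩ := hz
    refine ⟨n + 1, fun i => if i = 0 then a else 0, ?_⟩
    rw [Finset.sum_range_succ', mul_assoc, inv_mul_cancel₀ (pow_ne_zero _ hx)]
    simp
  | zero => exact ⟨0, 0, by simp⟩
  | add z w _ _ hz hw =>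
    obtain ⟨k, a, ha⟩ := hz
    obtain ⟨m, b, hb⟩ := hw
    obtain ⟨a', ha'⟩ := hraise ha m
    obtain ⟨b', hb'⟩ := hraise hb k
    refine ⟨k + m, fun i => a' i + b' i, ?_⟩
    rw [add_comm m k] at hb'
    rw [add_mul, ha', hb', ← Finset.sum_add_distrib]
    exact Finset.sum_congr rfl fun i _ => by rw [map_add, add_mul]
  | smul c z _ hz =>
    obtain ⟨k, a, ha⟩ := hz
    refine ⟨k, fun i => c • a i, ?_⟩
    rw [smul_mul_assoc, ha, Finset.smul_sum]
    exact Finset.sum_congr rfl fun i _ => by rw [map_smul, smul_mul_assoc]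

theorem mul_inv_pow_mem_lowerTerms {z : F} (hz : z ∈ lowerTerms φ x) (n : ℕ) :
    z * (x ^ n)⁻¹ ∈ lowerTerms φ x := by
  induction hz using Submodule.span_induction with
  | mem z hz =>
    obtain ⟨a, m, rfl⟩ := hz
    refine Submodule.subset_span ⟨a, n + m, ?_⟩
    rw [mul_assoc, ← mul_inv_rev, ← pow_add, add_assoc]
  | zero => simp
  | add z w _ _ hz hw => rw [add_mul]; exact add_mem hz hw
  | smul c z _ hz => rw [smul_mul_assoc]; exact Submodule.smul_mem _ _ hz

/-- After multiplication by x^k, r is the coefficient of x^k while z contributes lower powers only.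
-/
theorem eq_zero_of_add_mem_lowerTerms (hx : x ≠ 0)
    (hind : ∀ (M : ℕ) (a : ℕ → R), ∑ n ∈ Finset.range M, φ (a n) * x ^ n = 0 → ∀ n < M, a n = 0)
    {r : R} {z : F} (hz : z ∈ lowerTerms φ x) (h : φ r + z = 0) : r = 0 := by
  obtain ⟨k, a, ha⟩ := exists_of_mem_lowerTerms hx hz
  have h1 := hind (k + 1) (fun i => if i = k then r else a i) (by
    rw [Finset.sum_range_succ, if_pos rfl, ← zero_mul (x ^ k), ← h, add_mul, ha, add_comm]
    congr 1
    refine Finset.sum_congr rfl fun i hi => ?_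
    rw [if_neg (Finset.mem_range.1 hi).ne]) k (Nat.lt_succ_self k)
  simpa using h1

theorem scaledInv_pow_mem {B : Subalgebra K F} (hx : x⁻¹ ∈ B) (n : ℕ) : scaledInv q x ^ n ∈ B :=
  pow_mem (Subalgebra.smul_mem _ hx _) n

variable (H : OreRelations q σ δ d φ x)
include H

theorem exists_deleteHom_eq_add (r : R) : ∃ z ∈ lowerTerms φ x, H.deleteHom r = φ r + z := by
  obtain ⟨m, hm⟩ := H.nilpotent r
  rw [deleteHom_apply, H.deleteFun_eq_sum (m := m + 1) fun n hn => hm n (by omega),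
    Finset.sum_range_succ', twistedOperator_zero H.higher, pow_zero, mul_one, add_comm]
  refine ⟨_, Submodule.sum_mem _ fun n _ => ?_, rfl⟩
  rw [scaledInv_pow, mul_smul_comm]
  exact Submodule.smul_mem _ _ (Submodule.subset_span ⟨_, n, rfl⟩)

section Independent

variable (hind : ∀ (M : ℕ) (a : ℕ → R), ∑ n ∈ Finset.range M, φ (a n) * x ^ n = 0 →
  ∀ n < M, a n = 0)
include hind

theorem deleteHom_injective : Function.Injective H.deleteHom := by
  rw [injective_iff_map_eq_zero]
  intro r hr
  obtain ⟨z, hz, h⟩ := H.exists_deleteHom_eq_add r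
  exact eq_zero_of_add_mem_lowerTerms H.x_ne_zero hind hz (h.symm.trans hr)

/-- Dividing by the top power x^M leaves φ(a_M) plus negative powers of x, so the top coefficient
vanishes. -/
theorem deleteHom_independent (M : ℕ) (a : ℕ → R)
    (h : ∑ n ∈ Finset.range M, H.deleteHom (a n) * x ^ n = 0) : ∀ n < M, a n = 0 := by
  induction M with
  | zero => intro n hn; omega
  | succ M ih =>
    have htop : a M = 0 := by
      rw [Finset.sum_range_succ] at h
      obtain ⟨z, hz, hr⟩ := H.exists_deleteHom_eq_add (a M)
      have h1 : φ (a M) + (z + ∑ n ∈ Finset.range M,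
          H.deleteHom (a n) * x ^ n * (x ^ M)⁻¹) = 0 := by
        have hx := pow_ne_zero M H.x_ne_zero
        have h2 : (∑ n ∈ Finset.range M, H.deleteHom (a n) * x ^ n +
            H.deleteHom (a M) * x ^ M) * (x ^ M)⁻¹ = 0 := by rw [h, zero_mul]
        rw [add_mul, mul_assoc _ (x ^ M), mul_inv_cancel₀ hx, mul_one, hr, Finset.sum_mul] at h2
        rw [← h2]
        abel
      refine eq_zero_of_add_mem_lowerTerms H.x_ne_zero hind
        (add_mem hz (Submodule.sum_mem _ fun n hn => ?_)) h1
      obtain ⟨k, rfl⟩ := Nat.exists_eq_add_of_lt (Finset.mem_range.1 hn)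
      obtain ⟨w, hw, hr'⟩ := H.exists_deleteHom_eq_add (a n)
      have h3 : H.deleteHom (a n) * x ^ n * (x ^ (n + k + 1))⁻¹ =
          H.deleteHom (a n) * (x ^ (k + 1))⁻¹ := by
        rw [show n + k + 1 = k + 1 + n by omega, pow_add, mul_inv_rev, mul_assoc, ← mul_assoc (x ^ n),
          mul_inv_cancel₀ (pow_ne_zero n H.x_ne_zero), one_mul]
      rw [h3, hr', add_mul]
      exact add_mem (Submodule.subset_span ⟨_, k, rfl⟩) (mul_inv_pow_mem_lowerTerms hw _)
    intro n hn
    rcases Nat.lt_succ_iff_lt_or_eq.1 hn with hn | rfl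
    · refine ih ?_ n hn
      rw [Finset.sum_range_succ, htop, map_zero, zero_mul, add_zero] at h
      exact h
    · exact htop

end Independent

/-- Double induction on the exponent n and the nilpotency bound k. In φ(r) x = x φ(σ⁻¹ r) - φ(δ σ⁻¹
r) the first term has already gained one x on the left, and the second has a smaller bound because
d_i δ is a multiple of d_{i+1}. -/
theorem exists_mul_pow_eq {B : Subalgebra K F} (hB : ∀ r, φ r ∈ B) (hx : x ∈ B) (n : ℕ) :
    ∀ (k : ℕ) (r : R), (∀ i, k ≤ i → d i r = 0) →
      ∃ (m : ℕ) (b : F), b ∈ B ∧ φ r * x ^ m = x ^ n * b := by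
  induction n with
  | zero => exact fun k r _ => ⟨0, φ r, hB r, by simp⟩
  | succ n ihn =>
    intro k
    induction k with
    | zero =>
      intro r hr
      have : r = 0 := by rw [← H.higher.zero r, hr 0 le_rfl]
      exact ⟨0, 0, B.zero_mem, by simp [this]⟩
    | succ k ihk =>
      intro r hr
      have hsymm := H.apply_symm_iterate_eq_zero hr 1
      obtain ⟨m, b, hb, h⟩ := ihn (k + 1) (σ.symm r) hsymm
      obtain ⟨m', b', hb', h'⟩ := ihk (δ (σ.symm r)) (by
        intro i hi
        rw [← H.higher.one]
        exact H.apply_apply_eq_zero hsymm 0 i hi)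
      have h1 : φ r * x = x * φ (σ.symm r) - φ (δ (σ.symm r)) := by
        rw [H.comm, AlgEquiv.apply_symm_apply, add_sub_cancel_right]
      refine ⟨1 + (m + m'), b * x ^ m' - b' * x ^ m,
        sub_mem (mul_mem hb (pow_mem hx _)) (mul_mem hb' (pow_mem hx _)), ?_⟩
      rw [pow_add, pow_one, ← mul_assoc, h1, sub_mul, mul_sub]
      congr 1
      · rw [pow_add, mul_assoc, ← mul_assoc (φ _), h, pow_succ']
        simp only [mul_assoc]
      · rw [add_comm m m', pow_add, ← mul_assoc, h', mul_assoc]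

theorem exists_inv_pow_mul_mem {B : Subalgebra K F} (hB : ∀ r, φ r ∈ B) (hx : x ∈ B) (r : R)
    (n : ℕ) : ∃ m : ℕ, (x ^ n)⁻¹ * φ r * x ^ m ∈ B := by
  obtain ⟨k, hk⟩ := H.nilpotent r
  obtain ⟨m, b, hb, h⟩ := H.exists_mul_pow_eq hB hx n k r hk
  refine ⟨m, ?_⟩
  rwa [mul_assoc, h, ← mul_assoc, inv_mul_cancel₀ (pow_ne_zero n H.x_ne_zero), one_mul]

theorem deleteHom_mem {B : Subalgebra K F} (hB : ∀ r, φ r ∈ B) (hx : x⁻¹ ∈ B) (r : R) :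
    H.deleteHom r ∈ B := by
  obtain ⟨m, hm⟩ := H.nilpotent r
  rw [deleteHom_apply, H.deleteFun_eq_sum hm]
  exact sum_mem fun n _ => mul_mem (hB _) (scaledInv_pow_mem hx n)

/-- The series is unitriangular: φ(r) is θ(r) minus terms in d_{n+1}, whose arguments have a smaller
nilpotency bound. -/
theorem mem_of_deleteHom_mem {B : Subalgebra K F} (hB : ∀ r, H.deleteHom r ∈ B) (hx : x⁻¹ ∈ B)
    (r : R) : φ r ∈ B := by
  have key : ∀ (m : ℕ) (r : R), (∀ n, m ≤ n → d n r = 0) → φ r ∈ B := by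
    intro m
    induction m using Nat.strong_induction_on with
    | _ m ih =>
      intro r hr
      rcases m with _ | m
      · have : r = 0 := by rw [← H.higher.zero r, hr 0 le_rfl]
        rw [this, map_zero]
        exact B.zero_mem
      · have h := H.deleteFun_eq_sum hr
        rw [Finset.sum_range_succ', twistedOperator_zero H.higher, pow_zero, mul_one] at h
        have h1 : φ r = deleteFun q σ d φ x r - ∑ n ∈ Finset.range m,
            φ (twistedOperator q σ d (n + 1) r) * scaledInv q x ^ (n + 1) := by
          rw [h, add_sub_cancel_left]
        rw [h1]
        refine sub_mem (hB r) (sum_mem fun n _ => mul_mem ?_ (scaledInv_pow_mem hx _))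
        rw [twistedOperator, map_smul]
        exact Subalgebra.smul_mem _ (ih m (Nat.lt_succ_self m) _
          (H.apply_apply_eq_zero (H.apply_symm_iterate_eq_zero hr _) n)) _
  obtain ⟨m, hm⟩ := H.nilpotent r
  exact key m r hm

end OreRelations

/-! ### q-commuting elements and subalgebras generated by initial variables -/

theorem pow_qCommute {K F : Type*} [Field K] [Ring F] [Algebra K F] {c : K} {y z : F}
    (h : y * z = c • (z * y)) : ∀ n : ℕ, y ^ n * z = c ^ n • (z * y ^ n)
  | 0 => by simp
  | n + 1 => by
    rw [pow_succ, mul_assoc, h, mul_smul_comm, ← mul_assoc, pow_qCommute h n, smul_mul_assoc,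
      smul_smul, pow_succ', mul_assoc]

theorem qCommute_symm {K F : Type*} [Field K] [DivisionRing F] [Algebra K F] {c : Kˣ} {y z : F}
    (h : y * z = (c : K) • (z * y)) : z * y = ((c⁻¹ : Kˣ) : K) • (y * z) := by
  rw [h, smul_smul, ← Units.val_mul, inv_mul_cancel, Units.val_one, one_smul]

theorem inv_pow_mul_mul_pow {K F : Type*} [Field K] [DivisionRing F] [Algebra K F] {c : Kˣ}
    {y z : F} (hy : y ≠ 0) (h : y * z = (c : K) • (z * y)) (n : ℕ) :
    (y ^ n)⁻¹ * z * y ^ n = ((c⁻¹ : Kˣ) : K) ^ n • z := by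
  have h1 : z * y ^ n = ((c⁻¹ : Kˣ) : K) ^ n • (y ^ n * z) := by
    rw [pow_qCommute h, smul_smul, ← mul_pow, ← Units.val_mul, inv_mul_cancel, Units.val_one,
      one_pow, one_smul]
  rw [mul_assoc, h1, mul_smul_comm, ← mul_assoc, inv_mul_cancel₀ (pow_ne_zero n hy), one_mul]

theorem qCommute_pow {K F : Type*} [Field K] [DivisionRing F] [Algebra K F] {c : K} {y z : F}
    (h : y * z = c • (z * y)) : ∀ n : ℕ, y * z ^ n = c ^ n • (z ^ n * y)
  | 0 => by simp
  | n + 1 => by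
    rw [pow_succ, ← mul_assoc, qCommute_pow h n, smul_mul_assoc, mul_assoc, h, mul_smul_comm,
      smul_smul, pow_succ, mul_assoc]

section below

variable {K A B : Type*} [Field K] [Ring A] [Algebra K A] [Ring B] [Algebra K B]

theorem below_le {S : Subalgebra K A} {X : ℕ → A} {l : ℕ} (h : ∀ i, 1 ≤ i → i < l → X i ∈ S) :
    below K X l ≤ S := by
  refine Algebra.adjoin_le ?_
  rintro a ⟨i, h1, hi, rfl⟩
  exact h i h1 hi

theorem below_algHom_ext {X : ℕ → A} {j : ℕ} {f g : below K X j →ₐ[K] B}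
    (h : ∀ l (h1 : 1 ≤ l) (hl : l < j),
      f ⟨X l, mem_below K X h1 hl⟩ = g ⟨X l, mem_below K X h1 hl⟩) : f = g := by
  refine AlgHom.adjoin_ext ?_
  rintro a ⟨l, h1, hl, rfl⟩
  exact h l h1 hl

theorem below_induction {X : ℕ → A} {j : ℕ} {p : below K X j → Prop}
    (gen : ∀ l (h1 : 1 ≤ l) (h : l < j), p ⟨X l, mem_below K X h1 h⟩)
    (scalar : ∀ c, p (algebraMap K _ c)) (add : ∀ a b, p a → p b → p (a + b))
    (mul : ∀ a b, p a → p b → p (a * b)) (r : below K X j) : p r := by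
  obtain ⟨r, hr⟩ := r
  induction hr using Algebra.adjoin_induction with
  | mem a ha =>
    obtain ⟨l, h1, hl, rfl⟩ := ha
    exact gen l h1 hl
  | algebraMap c => exact scalar c
  | add a b ha hb iha ihb => exact add ⟨a, ha⟩ ⟨b, hb⟩ iha ihb
  | mul a b ha hb iha ihb => exact mul ⟨a, ha⟩ ⟨b, hb⟩ iha ihb

theorem below_map_mem {S : Subalgebra K B} {X : ℕ → A} {j : ℕ} {f : below K X j →ₐ[K] B}
    (hf : ∀ l (h1 : 1 ≤ l) (h : l < j), f ⟨X l, mem_below K X h1 h⟩ ∈ S) (r : below K X j) :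
    f r ∈ S := by
  induction r using below_induction with
  | gen l h1 h => exact hf l h1 h
  | scalar c => rw [AlgHom.commutes]; exact Subalgebra.algebraMap_mem _ c
  | add a b ha hb => rw [map_add]; exact add_mem ha hb
  | mul a b ha hb => rw [map_mul]; exact mul_mem ha hb

theorem exists_eq_of_mem_below {X : ℕ → A} {x : ℕ → B} {j : ℕ} {f : below K X j →ₐ[K] B}
    (hf : ∀ l (h1 : 1 ≤ l) (h : l < j), f ⟨X l, mem_below K X h1 h⟩ = x l) {z : B}
    (hz : z ∈ below K x j) : ∃ r, f r = z := by
  have : below K x j ≤ f.range := below_le fun i h1 hi => ⟨_, hf i h1 hi⟩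
  exact this hz

end below

/-! ### The invariant of the algorithm and its induction step -/

namespace QuantumNilpotentAlgebra

variable {K A F : Type*} [Field K] [Ring A] [Algebra K A] [DivisionRing F] [Algebra K F] {N : ℕ}
  (D : QuantumNilpotentAlgebra K A N)

theorem free_powers {j : ℕ} (h1 : 1 ≤ j) (hN : j ≤ N) (M : ℕ) (a : ℕ → below K D.X j)
    (h : ∑ n ∈ Finset.range M, (a n : A) * D.X j ^ n = 0) : ∀ n < M, a n = 0 := by
  obtain ⟨p, -, hp⟩ := (D.ore j h1 hN).free 0 (Subalgebra.zero_mem _)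
  have h0 : (0 : ℕ →₀ below K D.X j) = p := hp 0 (by simp)
  have hsum : (∑ n ∈ Finset.range M, Finsupp.single n (a n)) = p := by
    refine hp _ ?_
    beta_reduce
    rw [← Finsupp.sum_finsetSum_index (fun _ => by simp) fun _ _ _ => by simp [add_mul], ← h]
    exact Finset.sum_congr rfl fun n _ => by rw [Finsupp.sum_single_index (by simp)]
  intro n hn
  have := DFunLike.congr_fun (hsum.trans h0.symm) n
  simpa [Finsupp.finsetSum_apply, Finsupp.single_apply, hn] using this

/-- At a stage of the deleting derivations algorithm, the elements `x_1, ..., x_N` generate an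
iterated Ore extension of the image of `A_{j-1}` under `φ`, without skew derivations. -/
structure IsStage (j : ℕ) (x : ℕ → F) (φ : below K D.X j →ₐ[K] F) : Prop where
  map_X : ∀ l (h1 : 1 ≤ l) (h : l < j), φ ⟨D.X l, mem_below K D.X h1 h⟩ = x l
  injective : Function.Injective φ
  qCommute : ∀ l i, j ≤ l → l ≤ N → 1 ≤ i → i < l →
    x l * x i = (D.lam l i : K) • (x i * x l)
  independent : ∀ l, j ≤ l → l ≤ N → LeftIndependentPowers (below K x l) (x l)

theorem isStage_start (ι : A →ₐ[K] F) (hι : Function.Injective ι) (x : ℕ → F)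
    (hx : ∀ l, 1 ≤ l → l ≤ N → x l = ι (D.X l)) :
    D.IsStage (N + 1) x (ι.comp (below K D.X (N + 1)).val) where
  map_X l h1 h := (hx l h1 (Nat.le_of_lt_succ h)).symm
  injective := hι.comp Subtype.val_injective
  qCommute l i h h' := by omega
  independent l h h' := by omega

section Step

variable {D} {j : ℕ} (h2 : 2 ≤ j) (hN : j ≤ N) {x : ℕ → F} {φ : below K D.X j →ₐ[K] F}
  {φ' : below K D.X (j + 1) →ₐ[K] F} (S : D.IsStage (j + 1) x φ')
  (hφ : ∀ l (h1 : 1 ≤ l) (h : l < j), φ ⟨D.X l, mem_below K D.X h1 h⟩ = x l)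

include S hφ in
theorem IsStage.restrict_apply (r : below K D.X j) :
    φ r = φ' (Subalgebra.inclusion (below_mono K D.X (Nat.le_succ j)) r) := by
  have : φ = φ'.comp (Subalgebra.inclusion (below_mono K D.X (Nat.le_succ j))) := by
    refine below_algHom_ext fun l h1 hl => ?_
    rw [hφ l h1 hl, ← S.map_X l h1 (Nat.lt_succ_of_lt hl)]
    rfl
  rw [this]
  rfl

include h2 hN S hφ in
theorem IsStage.restrict_independent (M : ℕ) (a : ℕ → below K D.X j)
    (h : ∑ n ∈ Finset.range M, φ (a n) * x j ^ n = 0) : ∀ n < M, a n = 0 := by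
  have hj : 1 ≤ j := Nat.le_of_succ_le h2
  refine D.free_powers hj hN M a ?_
  let X' : below K D.X (j + 1) := ⟨D.X j, mem_below K D.X hj (Nat.lt_succ_self j)⟩
  have h1 : φ' (∑ n ∈ Finset.range M,
      Subalgebra.inclusion (below_mono K D.X (Nat.le_succ j)) (a n) * X' ^ n) = φ' 0 := by
    rw [map_sum, map_zero, ← h]
    refine Finset.sum_congr rfl fun n _ => ?_
    rw [map_mul, map_pow, S.map_X j hj (Nat.lt_succ_self j), S.restrict_apply hφ]
  have h3 := congrArg (below K D.X (j + 1)).val (S.injective h1)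
  rw [map_sum, map_zero] at h3
  rw [← h3]
  refine Finset.sum_congr rfl fun n _ => ?_
  rw [map_mul, map_pow, Subalgebra.coe_val, Subalgebra.coe_inclusion]

include h2 hN S hφ in
theorem IsStage.oreRelations :
    OreRelations (D.q j : K) (D.σ j) (D.δ j) (D.d j) φ (x j) where
  q_ne_zero := Units.ne_zero _
  q_ne_one h := D.q_ne_one j h2 hN (Units.val_eq_one.1 h)
  higher := D.higher j h2 hN
  nilpotent := D.locallyNilpotent j h2 hN
  iterative := D.iterative j h2 hN
  x_ne_zero h := by
    -- If x_j were 0, the coefficients 0 and 1 would give a relation 0 + 1 · x_j = 0.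
    have := S.restrict_independent h2 hN hφ 2 (fun n => if n = 0 then 0 else 1)
      (by simp [Finset.sum_range_succ, h]) 1 (by omega)
    have h1 : (1 : below K D.X j) = 0 := by simpa using this
    have := D.nontrivial
    exact one_ne_zero (α := A) (congrArg Subtype.val h1)
  comm r := by
    have hj : 1 ≤ j := Nat.le_of_succ_le h2
    rw [S.restrict_apply hφ, S.restrict_apply hφ, S.restrict_apply hφ,
      ← S.map_X j hj (Nat.lt_succ_self j), ← map_mul, ← map_mul, ← map_add]
    congr 1
    exact Subtype.ext ((D.ore j hj hN).comm r)

/-- The homomorphism from `A_{j-1}` that sends `X_l` to its successor in the deleting derivations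
algorithm. -/
noncomputable def IsStage.next : below K D.X j →ₐ[K] F := (S.oreRelations h2 hN hφ).deleteHom

theorem IsStage.next_injective : Function.Injective (S.next h2 hN hφ) :=
  (S.oreRelations h2 hN hφ).deleteHom_injective (S.restrict_independent h2 hN hφ)

include S hφ in
-- For l > j the derivation δ_l is already deleted, so x_l acts on the image of A_{j-1} through σ_l
-- alone. The element b is the form in which `σ_d` speaks of σ_l(r) inside A_{j-1}.
theorem IsStage.exists_mul_comm {l : ℕ} (hl : j + 1 ≤ l) (hlN : l ≤ N) (r : below K D.X j) :
    ∃ b : below K D.X j,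
      (b : A) = D.σ l (Subalgebra.inclusion (below_mono K D.X (Nat.le_of_succ_le hl)) r) ∧
        x l * φ r = φ b * x l := by
  induction r using below_induction with
  | gen i h1 h =>
    refine ⟨(D.lam l i : K) • ⟨D.X i, mem_below K D.X h1 h⟩, ?_, ?_⟩
    · rw [Subalgebra.coe_smul, ← D.σ_X l i (by omega) hlN h1 (by omega)]
      rfl
    · rw [map_smul, hφ i h1 h, smul_mul_assoc]
      exact S.qCommute l i hl hlN h1 (by omega)
  | scalar c =>
    refine ⟨algebraMap K _ c, ?_, ?_⟩
    · rw [AlgHom.commutes, AlgEquiv.commutes, Subalgebra.coe_algebraMap,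
        Subalgebra.coe_algebraMap]
    · rw [AlgHom.commutes, Algebra.commutes]
  | add a b ha hb =>
    obtain ⟨a', ha, ha'⟩ := ha
    obtain ⟨b', hb, hb'⟩ := hb
    exact ⟨a' + b', by rw [Subalgebra.coe_add, ha, hb, map_add, map_add,
      Subalgebra.coe_add], by rw [map_add, map_add, mul_add, add_mul, ha', hb']⟩
  | mul a b ha hb =>
    obtain ⟨a', ha, ha'⟩ := ha
    obtain ⟨b', hb, hb'⟩ := hb
    refine ⟨a' * b', by rw [Subalgebra.coe_mul, ha, hb, map_mul, map_mul, Subalgebra.coe_mul], ?_⟩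
    rw [map_mul, map_mul, ← mul_assoc, ha', mul_assoc, hb', mul_assoc]

theorem σ_symm_iterate_X (D : QuantumNilpotentAlgebra K A N) {j i : ℕ} (h2 : 2 ≤ j) (hN : j ≤ N)
    (h1 : 1 ≤ i) (h : i < j) (n : ℕ) :
    (D.σ j).symm^[n] ⟨D.X i, mem_below K D.X h1 h⟩ =
      (((D.lam j i)⁻¹ : Kˣ) : K) ^ n • (⟨D.X i, mem_below K D.X h1 h⟩ : below K D.X j) := by
  induction n with
  | zero => simp
  | succ n ih =>
    have hσ : D.σ j ⟨D.X i, mem_below K D.X h1 h⟩ =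
        (D.lam j i : K) • (⟨D.X i, mem_below K D.X h1 h⟩ : below K D.X j) :=
      Subtype.ext (D.σ_X j i h2 hN h1 h)
    rw [Function.iterate_succ_apply', ih, map_smul, pow_succ, mul_smul]
    congr 1
    rw [AlgEquiv.symm_apply_eq, map_smul, hσ, smul_smul, ← Units.val_mul, inv_mul_cancel,
      Units.val_one, one_smul]

include S hφ in
theorem IsStage.mul_twistedOperator (h2 : 2 ≤ j) (hN : j ≤ N) {l i : ℕ} (hl : j + 1 ≤ l)
    (hlN : l ≤ N) (h1 : 1 ≤ i) (h : i < j) (n : ℕ) :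
    x l * φ (twistedOperator (D.q j : K) (D.σ j) (D.d j) n ⟨D.X i, mem_below K D.X h1 h⟩) =
      ((D.lam l j : K) ^ n * D.lam l i) •
        (φ (twistedOperator (D.q j : K) (D.σ j) (D.d j) n ⟨D.X i, mem_below K D.X h1 h⟩) *
          x l) := by
  let a : below K D.X j := ⟨D.X i, mem_below K D.X h1 h⟩
  have hd : x l * φ (D.d j n a) = ((D.lam l j : K) ^ n * D.lam l i) • (φ (D.d j n a) * x l) := by
    obtain ⟨b, hb, hb'⟩ := S.exists_mul_comm hφ hl hlN (D.d j n a)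
    have hσ := D.σ_d j l n h2 hl hlN a ((D.lam l i : K) • a)
      (D.σ_X l i (by omega) hlN h1 (by omega)).symm
    have hb2 : b = ((D.lam l j : K) ^ n * D.lam l i) • D.d j n a := by
      refine Subtype.ext (hb.trans (hσ.trans ?_))
      rw [map_smul]
      simp [smul_smul]
    rw [hb', hb2, map_smul, smul_mul_assoc]
  rw [twistedOperator, D.σ_symm_iterate_X h2 hN h1 h]
  simp only [map_smul, smul_mul_assoc, mul_smul_comm]
  rw [hd, smul_comm (_ * _) (_ ^ _), smul_comm (_ * _) (_ ^ _)]

/-- In degree n, `σ_d` contributes λ_{l,j}^n and x_j^{-n} contributes λ_{l,j}^{-n}. These cancel, so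
every term of the series has the same commutation factor λ_{l,i}. -/
theorem IsStage.mul_next {l i : ℕ} (hl : j + 1 ≤ l) (hlN : l ≤ N) (h1 : 1 ≤ i) (h : i < j) :
    x l * S.next h2 hN hφ ⟨D.X i, mem_below K D.X h1 h⟩ =
      (D.lam l i : K) • (S.next h2 hN hφ ⟨D.X i, mem_below K D.X h1 h⟩ * x l) := by
  have H := S.oreRelations h2 hN hφ
  obtain ⟨m, hm⟩ := H.nilpotent ⟨D.X i, mem_below K D.X h1 h⟩
  rw [IsStage.next, OreRelations.deleteHom_apply, H.deleteFun_eq_sum hm, Finset.mul_sum,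
    Finset.sum_mul, Finset.smul_sum]
  refine Finset.sum_congr rfl fun n _ => ?_
  have hx : x l * OreRelations.scaledInv (D.q j : K) (x j) =
      (((D.lam l j)⁻¹ : Kˣ) : K) • (OreRelations.scaledInv (D.q j : K) (x j) * x l) := by
    have h3 := S.qCommute l j hl hlN (by omega) (by omega)
    have h4 : x l * (x j)⁻¹ = (((D.lam l j)⁻¹ : Kˣ) : K) • ((x j)⁻¹ * x l) := by
      have h5 : (x j)⁻¹ * (x l * x j) * (x j)⁻¹ =
          (x j)⁻¹ * ((D.lam l j : K) • (x j * x l)) * (x j)⁻¹ := by rw [h3]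
      rw [mul_assoc, mul_assoc, mul_inv_cancel₀ H.x_ne_zero, mul_one, mul_smul_comm, ← mul_assoc,
        inv_mul_cancel₀ H.x_ne_zero, one_mul, smul_mul_assoc] at h5
      rw [h5, smul_smul, ← Units.val_mul, inv_mul_cancel, Units.val_one, one_smul]
    rw [OreRelations.scaledInv, mul_smul_comm, h4, smul_mul_assoc, smul_comm]
  rw [← mul_assoc, S.mul_twistedOperator hφ h2 hN hl hlN h1 h, smul_mul_assoc, mul_assoc,
    qCommute_pow hx, mul_smul_comm, smul_smul, ← mul_assoc]
  congr 1
  rw [mul_right_comm, ← mul_pow, ← Units.val_mul, mul_inv_cancel, Units.val_one, one_pow, one_mul]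

variable {x' : ℕ → F} (hge : ∀ l, j ≤ l → l ≤ N → x' l = x l)
  (hlt : ∀ l (h1 : 1 ≤ l) (h : l < j),
    x' l = S.next h2 hN hφ ⟨D.X l, mem_below K D.X h1 h⟩)

include h2 hN S hφ hge hlt

theorem IsStage.next_qCommute {l i : ℕ} (hl : j ≤ l) (hlN : l ≤ N) (h1 : 1 ≤ i) (hi : i < l) :
    x' l * x' i = (D.lam l i : K) • (x' i * x' l) := by
  rw [hge l hl hlN]
  rcases Nat.lt_or_ge i j with hij | hij
  · rw [hlt i h1 hij]
    rcases Nat.eq_or_lt_of_le hl with rfl | hl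
    · have h := (S.oreRelations h2 hN hφ).x_mul_deleteHom ⟨D.X i, mem_below K D.X h1 hij⟩
      have hσ : D.σ j ⟨D.X i, mem_below K D.X h1 hij⟩ =
          (D.lam j i : K) • (⟨D.X i, mem_below K D.X h1 hij⟩ : below K D.X j) :=
        Subtype.ext (D.σ_X j i h2 hN h1 hij)
      rw [hσ, map_smul, smul_mul_assoc] at h
      exact h
    · exact S.mul_next h2 hN hφ hl hlN h1 hij
  · rw [hge i hij (by omega)]
    exact S.qCommute l i (by omega) hlN h1 hi

/-- The case `l = N + 1` compares A^{(j+1)} with A^{(j)}; smaller `l` serve to clear denominators in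
`IsStage.isStage_next`. Only generators of index below j differ, and the series and its inversion
express each kind through the other and x_j⁻¹. -/
theorem IsStage.sameFractions {l : ℕ} (hl : j < l) (hlN : l ≤ N + 1) :
    SameFractions (below K x l) (below K x' l) (x j) := by
  have H := S.oreRelations h2 hN hφ
  have hx := H.x_ne_zero
  have hmem : x j ∈ below K x l := mem_below K x (by omega) hl
  have hmem' : x j ∈ below K x' l := by
    rw [← hge j le_rfl hN]
    exact mem_below K x' (by omega) hl
  have hφB : ∀ r, φ r ∈ below K x l := below_map_mem fun i h1 h => by
    rw [hφ i h1 h]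
    exact mem_below K x h1 (by omega)
  have hφC : ∀ r, S.next h2 hN hφ r ∈ below K x' l := below_map_mem fun i h1 h => by
    rw [← hlt i h1 h]
    exact mem_below K x' h1 (by omega)
  have hupper : ∀ i, j < i → i ≤ N → ∀ n, ((x j) ^ n)⁻¹ * x i * x j ^ n =
      (((((D.lam i j)⁻¹)⁻¹ : Kˣ) : K)) ^ n • x i := fun i hi hiN n =>
    inv_pow_mul_mul_pow hx (qCommute_symm (S.qCommute i j hi hiN (by omega) hi)) n
  have oreB : IsOreElement (below K x l) (x j) := by
    refine isOreElement_adjoin hx hmem ?_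
    rintro s ⟨i, h1, hi, rfl⟩ n
    rcases Nat.lt_trichotomy i j with h | rfl | h
    · rw [← hφ i h1 h]
      exact H.exists_inv_pow_mul_mem hφB hmem _ n
    · refine ⟨n, ?_⟩
      rw [mul_assoc, ← pow_succ', pow_succ, ← mul_assoc, inv_mul_cancel₀ (pow_ne_zero n hx),
        one_mul]
      exact hmem
    · refine ⟨n, ?_⟩
      rw [hupper i h (by omega)]
      exact Subalgebra.smul_mem _ (mem_below K x h1 hi) _
  have oreC : IsOreElement (below K x' l) (x j) := by
    refine isOreElement_adjoin hx hmem' ?_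
    rintro s ⟨i, h1, hi, rfl⟩ n
    refine ⟨n, ?_⟩
    rcases Nat.lt_trichotomy i j with h | rfl | h
    · have hc := S.next_qCommute h2 hN hφ hge hlt le_rfl hN h1 h
      rw [hge j le_rfl hN] at hc
      rw [inv_pow_mul_mul_pow hx hc]
      exact Subalgebra.smul_mem _ (mem_below K x' h1 hi) _
    · rw [hge i le_rfl hN, mul_assoc, ← pow_succ', pow_succ, ← mul_assoc,
        inv_mul_cancel₀ (pow_ne_zero n hx), one_mul]
      exact hmem'
    · rw [hge i h.le (by omega), hupper i h (by omega), ← hge i h.le (by omega)]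
      exact Subalgebra.smul_mem _ (mem_below K x' h1 hi) _
  refine ⟨hx, hmem, hmem', oreB, oreC, ?_, ?_⟩
  · have : below K x l ≤ fractionAlgebra (below K x' l) hmem' hx oreC := below_le fun i h1 hi => by
      rcases Nat.lt_or_ge i j with h | h
      · rw [← hφ i h1 h]
        exact H.mem_of_deleteHom_mem (fun r => le_fractionAlgebra (hφC r))
          inv_mem_fractionAlgebra _
      · rw [← hge i h (by omega)]
        exact le_fractionAlgebra (mem_below K x' h1 hi)
    exact fun b hb => this hb
  · have : below K x' l ≤ fractionAlgebra (below K x l) hmem hx oreB := below_le fun i h1 hi => by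
      rcases Nat.lt_or_ge i j with h | h
      · rw [hlt i h1 h]
        exact H.deleteHom_mem (fun r => le_fractionAlgebra (hφB r)) inv_mem_fractionAlgebra _
      · rw [hge i h (by omega)]
        exact le_fractionAlgebra (mem_below K x h1 hi)
    exact fun b hb => this hb

theorem IsStage.isStage_next : D.IsStage j x' (S.next h2 hN hφ) where
  map_X l h1 h := (hlt l h1 h).symm
  injective := S.next_injective h2 hN hφ
  qCommute l i hl hlN h1 hi := S.next_qCommute h2 hN hφ hge hlt hl hlN h1 hi
  independent l hl hlN := by
    rcases Nat.eq_or_lt_of_le hl with rfl | hl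
    · intro M p hp hsum
      have hex : ∀ n, ∃ r, n < M → S.next h2 hN hφ r = p n := fun n => by
        by_cases hn : n < M
        · obtain ⟨r, hr⟩ := exists_eq_of_mem_below (fun l h1 h => (hlt l h1 h).symm) (hp n hn)
          exact ⟨r, fun _ => hr⟩
        · exact ⟨0, fun h => absurd h hn⟩
      choose r hr using hex
      intro n hn
      rw [← hr n hn, (S.oreRelations h2 hN hφ).deleteHom_independent
        (S.restrict_independent h2 hN hφ) M r ?_ n hn, map_zero]
      rw [← hsum]
      refine Finset.sum_congr rfl fun k hk => ?_
      rw [← hr k (Finset.mem_range.1 hk), hge j le_rfl hN]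
      rfl
    · intro M p hp hsum
      have hF := S.sameFractions h2 hN hφ hge hlt hl (Nat.le_succ_of_le hlN)
      have hc := S.qCommute l j hl hlN (by omega) hl
      rw [hge l hl.le hlN] at hsum
      have hex : ∀ n, ∃ k, n < M → p n * x j ^ k ∈ below K x l := fun n => by
        by_cases hn : n < M
        · obtain ⟨k, hk⟩ := hF.right_le _ (hp n hn)
          exact ⟨k, fun _ => hk⟩
        · exact ⟨0, fun h => absurd h hn⟩
      choose k hk using hex
      obtain ⟨m, hm⟩ := ((Finset.range M).image k).exists_le
      have hpm : ∀ n < M, p n * x j ^ m ∈ below K x l := fun n hn => by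
        have h := mul_mem (hk n hn) (pow_mem hF.mem_left (m - k n))
        rwa [mul_assoc, ← pow_add, Nat.add_sub_of_le
          (hm _ (Finset.mem_image_of_mem k (Finset.mem_range.2 hn)))] at h
      -- Right multiplication by x_j^m brings all coefficients back to the previous stage; moving
      -- x_j^m past x_l^n costs λ_{l,j}^{mn}.
      have h0 := S.independent l hl hlN M
        (fun n => ((D.lam l j : K) ^ m) ^ n • (p n * x j ^ m))
        (fun n hn => Subalgebra.smul_mem _ (hpm n hn) _) (by
          rw [← zero_mul (x j ^ m), ← hsum, Finset.sum_mul]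
          refine Finset.sum_congr rfl fun n _ => ?_
          rw [mul_assoc, pow_qCommute (qCommute_pow hc m) n, smul_mul_assoc, mul_smul_comm,
            mul_assoc])
      intro n hn
      have h1 := h0 n hn
      rw [smul_eq_zero, mul_eq_zero] at h1
      rcases h1 with h1 | h1 | h1
      · exact absurd h1 (pow_ne_zero _ (pow_ne_zero _ (Units.ne_zero _)))
      · exact h1
      · exact absurd h1 (pow_ne_zero _ hF.ne_zero)

end Step

end QuantumNilpotentAlgebra

/-! ### Homomorphisms constructed from their graphs -/

section Graph

variable {K B : Type*} [Field K] [Ring B] [Algebra K B]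

/-- The span of the b v_l^n contains 1 and, by q-commutation, is stable under right multiplication
by every generator. -/
theorem exists_eq_sum_of_mem_below_succ {v : ℕ → B} {l : ℕ} {c : ℕ → K}
    (hv : ∀ i, 1 ≤ i → i < l → v l * v i = c i • (v i * v l)) {z : B}
    (hz : z ∈ below K v (l + 1)) :
    ∃ (M : ℕ) (p : ℕ → B), (∀ n, p n ∈ below K v l) ∧
      z = ∑ n ∈ Finset.range M, p n * v l ^ n := by
  let V : Submodule K B := Submodule.span K {y | ∃ b ∈ below K v l, ∃ n : ℕ, y = b * v l ^ n}
  have key : ∀ y ∈ V, y * z ∈ V := by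
    induction hz using Algebra.adjoin_induction with
    | mem a ha =>
      obtain ⟨i, h1, hi, rfl⟩ := ha
      intro y hy
      induction hy using Submodule.span_induction with
      | mem y hy =>
        obtain ⟨b, hb, n, rfl⟩ := hy
        rcases Nat.lt_succ_iff_lt_or_eq.1 hi with hi | rfl
        · rw [mul_assoc, pow_qCommute (hv i h1 hi), mul_smul_comm, ← mul_assoc]
          exact V.smul_mem _ (Submodule.subset_span ⟨_, mul_mem hb (mem_below K v h1 hi), n, rfl⟩)
        · rw [mul_assoc, ← pow_succ]
          exact Submodule.subset_span ⟨b, hb, n + 1, rfl⟩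
      | zero => rw [zero_mul]; exact V.zero_mem
      | add y w _ _ hy hw => rw [add_mul]; exact V.add_mem hy hw
      | smul k y _ hy => rw [smul_mul_assoc]; exact V.smul_mem _ hy
    | algebraMap k =>
      intro y hy
      rw [← Algebra.commutes, ← Algebra.smul_def]
      exact V.smul_mem _ hy
    | add a b _ _ ha hb => intro y hy; rw [mul_add]; exact V.add_mem (ha y hy) (hb y hy)
    | mul a b _ _ ha hb => intro y hy; rw [← mul_assoc]; exact hb _ (ha y hy)
  have hzV : z ∈ V := by
    have h := key 1 (Submodule.subset_span ⟨1, Subalgebra.one_mem _, 0, by simp⟩)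
    rwa [one_mul] at h
  have hsum : ∃ p : ℕ →₀ B, (∀ n, p n ∈ below K v l) ∧ z = p.sum fun n b => b * v l ^ n := by
    clear key hz
    induction hzV using Submodule.span_induction with
    | mem y hy =>
      obtain ⟨b, hb, n, rfl⟩ := hy
      refine ⟨Finsupp.single n b, fun m => ?_, by rw [Finsupp.sum_single_index (by simp)]⟩
      rw [Finsupp.single_apply]
      split_ifs
      · exact hb
      · exact Subalgebra.zero_mem _
    | zero => exact ⟨0, fun _ => Subalgebra.zero_mem _, by simp⟩
    | add y w _ _ hy hw =>
      obtain ⟨p, hp, rfl⟩ := hy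
      obtain ⟨r, hr, rfl⟩ := hw
      exact ⟨p + r, fun n => add_mem (hp n) (hr n),
        (Finsupp.sum_add_index' (by simp) fun _ _ _ => add_mul _ _ _).symm⟩
    | smul k y _ hy =>
      obtain ⟨p, hp, rfl⟩ := hy
      refine ⟨k • p, fun n => Subalgebra.smul_mem _ (hp n) k, ?_⟩
      rw [Finsupp.sum_smul_index' (by simp), Finsupp.smul_sum]
      exact Finsupp.sum_congr fun n _ => (smul_mul_assoc _ _ _).symm
  obtain ⟨p, hp, hz⟩ := hsum
  obtain ⟨M, hM⟩ := p.support.exists_nat_subset_range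
  exact ⟨M, p, hp, hz.trans (Finsupp.sum_of_support_subset p hM _ (by simp))⟩

variable {F Q : Type*} [DivisionRing F] [Algebra K F] [Ring Q] [Algebra K Q]

theorem fst_mem_below {u : ℕ → F} {w : ℕ → Q} {l : ℕ} {z : F × Q}
    (hz : z ∈ below K (fun i => (u i, w i)) l) : z.1 ∈ below K u l := by
  have : below K (fun i => (u i, w i)) l ≤ (below K u l).comap (AlgHom.fst K F Q) :=
    below_le fun i h1 hi => mem_below K u h1 hi
  exact this hz

/-- If Σ p_n v_l^n has first component 0, independence in F kills the first components of the p_n,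
and induction then kills the second ones. On the side of Q only the relations matter, not
independence. -/
theorem graph_functional {u : ℕ → F} {w : ℕ → Q} {j m : ℕ} {c : ℕ → ℕ → K}
    (hu : ∀ l i, j ≤ l → l < m → 1 ≤ i → i < l → u l * u i = c l i • (u i * u l))
    (hw : ∀ l i, j ≤ l → l < m → 1 ≤ i → i < l → w l * w i = c l i • (w i * w l))
    (hind : ∀ l, j ≤ l → l < m → LeftIndependentPowers (below K u l) (u l))
    (h0 : ∀ b : Q, ((0 : F), b) ∈ below K (fun i => (u i, w i)) j → b = 0) {l : ℕ}
    (hl : j ≤ l) : l ≤ m → ∀ b : Q, ((0 : F), b) ∈ below K (fun i => (u i, w i)) l → b = 0 := by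
  induction l, hl using Nat.le_induction with
  | base => exact fun _ => h0
  | succ l hl ih =>
    intro hlm b hb
    have hv : ∀ i, 1 ≤ i → i < l → (fun i => (u i, w i)) l * (fun i => (u i, w i)) i =
        c l i • ((fun i => (u i, w i)) i * (fun i => (u i, w i)) l) := fun i h1 hi =>
      Prod.ext (hu l i hl hlm h1 hi) (hw l i hl hlm h1 hi)
    obtain ⟨M, p, hp, hsum⟩ := exists_eq_sum_of_mem_below_succ (c := c l) hv hb
    have hfst := congrArg (AlgHom.fst K F Q) hsum
    have hsnd := congrArg (AlgHom.snd K F Q) hsum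
    rw [map_sum] at hfst hsnd
    have hp1 := hind l hl hlm M (fun n => (p n).1) (fun n _ => fst_mem_below (hp n)) hfst.symm
    have hp2 : ∀ n < M, (p n).2 = 0 := fun n hn => ih (by omega) _ (by
      rw [← hp1 n hn]
      exact hp n)
    refine hsnd.trans (Finset.sum_eq_zero fun n hn => ?_)
    rw [map_mul, AlgHom.snd_apply, hp2 n (Finset.mem_range.1 hn), zero_mul]

/-- By hypothesis the projection of the graph to F is injective; its inverse followed by the second
projection is the map. -/
theorem exists_algHom_of_graph {u : ℕ → F} {w : ℕ → Q} {m : ℕ}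
    (h : ∀ b : Q, ((0 : F), b) ∈ below K (fun i => (u i, w i)) m → b = 0) :
    ∃ g : below K u m →ₐ[K] Q, ∀ l (h1 : 1 ≤ l) (hl : l < m), g ⟨u l, mem_below K u h1 hl⟩ = w l := by
  let G := below K (fun i => (u i, w i)) m
  let f : G →ₐ[K] F := (AlgHom.fst K F Q).comp G.val
  have hf : Function.Injective f := by
    rw [injective_iff_map_eq_zero]
    rintro ⟨⟨a, b⟩, hab⟩ h0
    have ha : a = 0 := h0
    subst ha
    have hb : b = 0 := h b hab
    subst hb
    rfl
  have hle : below K u m ≤ f.range :=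
    below_le fun i h1 hi => ⟨⟨_, mem_below K (fun i => (u i, w i)) h1 hi⟩, rfl⟩
  refine ⟨((AlgHom.snd K F Q).comp G.val).comp
    ((AlgEquiv.ofInjective f hf).symm.toAlgHom.comp (Subalgebra.inclusion hle)), fun l h1 hl => ?_⟩
  have : (AlgEquiv.ofInjective f hf).symm (Subalgebra.inclusion hle ⟨u l, mem_below K u h1 hl⟩) =
      ⟨_, mem_below K (fun i => (u i, w i)) h1 hl⟩ := by
    rw [AlgEquiv.symm_apply_eq]
    rfl
  exact congrArg (fun z : G => z.1.2) this

end Graph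

/-! ### Existence of the algorithm and of the homomorphisms g_j -/

namespace DeletingDerivations

variable {K A F : Type*} [Field K] [Ring A] [Algebra K A] [DivisionRing F] [Algebra K F] {N : ℕ}
  {D : QuantumNilpotentAlgebra K A N} {ι : A →ₐ[K] F}

theorem alg_eq (E : DeletingDerivations D ι) (j : ℕ) : E.alg j = below K (E.x j) (N + 1) := by
  simp only [alg, below, Nat.lt_succ_iff]

theorem exists_isStage (E : DeletingDerivations D ι) (hι : Function.Injective ι) {j : ℕ}
    (hN : j ≤ N + 1) : 2 ≤ j → ∃ φ : below K D.X j →ₐ[K] F, D.IsStage j (E.x j) φ := by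
  induction hN using Nat.decreasingInduction with
  | self => exact fun _ => ⟨_, D.isStage_start ι hι _ E.x_start⟩
  | of_succ j hj ih =>
    intro h2
    have hN := Nat.lt_succ_iff.1 hj
    obtain ⟨φ', S⟩ := ih (by omega)
    -- The sum in `x_of_lt` is `deleteFun` for the given transport, so the invariant holds for every
    -- `E`, not only for a constructed one.
    exact ⟨_, S.isStage_next h2 hN (fun l h1 h => E.transport_X j l h2 hN h1 h)
      (fun l hl hlN => E.x_of_ge j l h2 hl hlN) (fun l h1 h => E.x_of_lt j l h2 hN h1 h)⟩

section Existence

open Classical in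
/-- A homomorphism from `A_{j-1}` that sends `X_l` to `x_l`, if there is one. -/
noncomputable def chosenTransport (D : QuantumNilpotentAlgebra K A N) (ι : A →ₐ[K] F) (j : ℕ)
    (x : ℕ → F) : below K D.X j →ₐ[K] F :=
  if h : ∃ φ : below K D.X j →ₐ[K] F,
      ∀ l (h1 : 1 ≤ l) (h : l < j), φ ⟨D.X l, mem_below K D.X h1 h⟩ = x l
  then h.choose else ι.comp (below K D.X j).val

theorem chosenTransport_X {j : ℕ} {x : ℕ → F} {φ : below K D.X (j + 1) →ₐ[K] F}
    (S : D.IsStage (j + 1) x φ) (l : ℕ) (h1 : 1 ≤ l) (h : l < j) :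
    chosenTransport D ι j x ⟨D.X l, mem_below K D.X h1 h⟩ = x l := by
  have hex : ∃ φ : below K D.X j →ₐ[K] F,
      ∀ l (h1 : 1 ≤ l) (h : l < j), φ ⟨D.X l, mem_below K D.X h1 h⟩ = x l :=
    ⟨φ.comp (Subalgebra.inclusion (below_mono K D.X (Nat.le_succ j))),
      fun l h1 h => S.map_X l h1 (Nat.lt_succ_of_lt h)⟩
  rw [chosenTransport, dif_pos hex]
  exact hex.choose_spec l h1 h

/-- One step of the deleting derivations algorithm. -/
noncomputable def nextVariables (D : QuantumNilpotentAlgebra K A N) (ι : A →ₐ[K] F) (j : ℕ)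
    (x : ℕ → F) (l : ℕ) : F :=
  if h : 1 ≤ l ∧ l < j then
    OreRelations.deleteFun (D.q j : K) (D.σ j) (D.d j) (chosenTransport D ι j x) (x j)
      ⟨D.X l, mem_below K D.X h.1 h.2⟩
  else x l

/-- The elements obtained from the generators after `k` steps of the algorithm. -/
noncomputable def variablesAfter (D : QuantumNilpotentAlgebra K A N) (ι : A →ₐ[K] F) :
    ℕ → ℕ → F
  | 0 => fun l => ι (D.X l)
  | k + 1 => nextVariables D ι (N - k) (variablesAfter D ι k)

/-- After k steps the current index is N + 1 - k, and the step to index j has pivot j. -/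
theorem variablesAfter_eq (D : QuantumNilpotentAlgebra K A N) (ι : A →ₐ[K] F) {j : ℕ}
    (hN : j ≤ N) : variablesAfter D ι (N + 1 - j) =
      nextVariables D ι j (variablesAfter D ι (N + 1 - (j + 1))) := by
  obtain ⟨k, rfl⟩ := Nat.exists_eq_add_of_le hN
  rw [show j + k + 1 - j = k + 1 by omega, show j + k + 1 - (j + 1) = k by omega, variablesAfter,
    Nat.add_sub_cancel]

theorem exists_isStage_variablesAfter (D : QuantumNilpotentAlgebra K A N) (ι : A →ₐ[K] F)
    (hι : Function.Injective ι) {j : ℕ} (hN : j ≤ N + 1) :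
    2 ≤ j → ∃ φ : below K D.X j →ₐ[K] F, D.IsStage j (variablesAfter D ι (N + 1 - j)) φ := by
  induction hN using Nat.decreasingInduction with
  | self =>
    intro _
    rw [Nat.sub_self]
    exact ⟨_, D.isStage_start ι hι _ fun l _ _ => rfl⟩
  | of_succ j hj ih =>
    intro h2
    have hN := Nat.lt_succ_iff.1 hj
    obtain ⟨φ', S⟩ := ih (by omega)
    rw [variablesAfter_eq D ι hN]
    refine ⟨_, S.isStage_next h2 hN (fun l h1 h => chosenTransport_X (ι := ι) S l h1 h)
      (fun l hl _ => dif_neg (by omega)) (fun l h1 h => dif_pos ⟨h1, h⟩)⟩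

theorem nonempty (D : QuantumNilpotentAlgebra K A N) (ι : A →ₐ[K] F)
    (hι : Function.Injective ι) : Nonempty (DeletingDerivations D ι) :=
  ⟨{  x := fun j => variablesAfter D ι (N + 1 - j)
      transport := fun j => chosenTransport D ι j (variablesAfter D ι (N + 1 - (j + 1)))
      transport_X := fun j l h2 hN h1 h => by
        obtain ⟨φ, S⟩ := exists_isStage_variablesAfter D ι hι (Nat.succ_le_succ hN) (by omega)
        exact chosenTransport_X S l h1 h
      x_start := fun l _ _ => by rw [Nat.sub_self]; rfl
      x_of_ge := fun j l _ hl hlN => by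
        rw [variablesAfter_eq D ι (hl.trans hlN)]
        exact dif_neg (by omega)
      x_of_lt := fun j l _ hN h1 h => by
        rw [variablesAfter_eq D ι hN]
        exact dif_pos ⟨h1, h⟩ }⟩

end Existence

variable (E : DeletingDerivations D ι) (hι : Function.Injective ι) {j : ℕ} (h2 : 2 ≤ j)
  (hN : j ≤ N)

include hι h2 hN in
theorem sameFractions : SameFractions (E.alg (j + 1)) (E.alg j) (E.x (j + 1) j) := by
  obtain ⟨φ', S⟩ := E.exists_isStage hι (Nat.succ_le_succ hN) (by omega)
  rw [alg_eq, alg_eq]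
  exact S.sameFractions h2 hN (fun l h1 h => E.transport_X j l h2 hN h1 h)
      (fun l hl hlN => E.x_of_ge j l h2 hl hlN) (fun l h1 h => E.x_of_lt j l h2 hN h1 h)
      (Nat.lt_succ_of_le hN) le_rfl

theorem gen_mem_pivotIdeal :
    E.gen (j + 1) j (Nat.le_of_succ_le h2) hN ∈ E.pivotIdeal j h2 hN :=
  TwoSidedIdeal.mem_asIdeal.2 (TwoSidedIdeal.subset_span rfl)

theorem mem_of_mem_pivotIdeal {P : CSpec (E.alg (j + 1))}
    (hP : E.gen (j + 1) j (Nat.le_of_succ_le h2) hN ∈ P.1) {a : E.alg (j + 1)}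
    (ha : a ∈ E.pivotIdeal j h2 hN) : a ∈ P.1 := by
  have h : TwoSidedIdeal.span {E.gen (j + 1) j (Nat.le_of_succ_le h2) hN} ≤ P.1 :=
    TwoSidedIdeal.span_le.2 (Set.singleton_subset_iff.2 hP)
  exact h (TwoSidedIdeal.mem_asIdeal.1 ha)

include hι in
theorem exists_g : ∃ g : E.alg j →ₐ[K] E.alg (j + 1) ⧸ E.pivotIdeal j h2 hN,
    ∀ (l : ℕ) (h1 : 1 ≤ l) (hl : l ≤ N), g (E.gen j l h1 hl) =
      Ideal.Quotient.mk (E.pivotIdeal j h2 hN) (E.gen (j + 1) l h1 hl) := by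
  obtain ⟨φ', S'⟩ := E.exists_isStage hι (Nat.succ_le_succ hN) (by omega)
  obtain ⟨φ, S⟩ := E.exists_isStage hι (Nat.le_succ_of_le hN) h2
  let π := Ideal.Quotient.mkₐ K (E.pivotIdeal j h2 hN)
  let w : ℕ → E.alg (j + 1) ⧸ E.pivotIdeal j h2 hN := fun l =>
    if h : 1 ≤ l ∧ l ≤ N then π (E.gen (j + 1) l h.1 h.2) else 0
  have hw : ∀ l (h1 : 1 ≤ l) (hl : l ≤ N), w l = π (E.gen (j + 1) l h1 hl) := fun l h1 hl =>
    dif_pos ⟨h1, hl⟩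
  have hT : ∀ r, E.transport j r ∈ E.alg (j + 1) := below_map_mem fun l h1 h => by
    rw [E.transport_X j l h2 hN h1 h]
    exact (E.gen (j + 1) l h1 (by omega)).2
  let χ : below K D.X j →ₐ[K] E.alg (j + 1) ⧸ E.pivotIdeal j h2 hN :=
    π.comp ((E.transport j).codRestrict (E.alg (j + 1)) hT)
  have hχ : ∀ l (h1 : 1 ≤ l) (h : l < j), χ ⟨D.X l, mem_below K D.X h1 h⟩ = w l := by
    intro l h1 h
    rw [hw l h1 (by omega)]
    exact congrArg π (Subtype.ext (E.transport_X j l h2 hN h1 h))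
  have hpivot : w j = 0 := by
    rw [hw j (by omega) hN]
    exact Ideal.Quotient.eq_zero_iff_mem.2 (E.gen_mem_pivotIdeal h2 hN)
  have hfun := graph_functional (K := K) (u := E.x j) (w := w) (j := j) (m := N + 1)
    (c := fun l i => (D.lam l i : K))
    (fun l i hl hlN h1 hi => S.qCommute l i hl (Nat.le_of_lt_succ hlN) h1 hi)
    (fun l i hl hlN h1 hi => by
      rcases Nat.eq_or_lt_of_le hl with rfl | hl
      -- The relations of the pivot with smaller variables hold in the quotient because its class is
      -- zero there.
      · rw [hpivot, zero_mul, mul_zero, smul_zero]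
      · rw [hw l (by omega) (by omega), hw i h1 (by omega), ← map_mul, ← map_mul, ← map_smul]
        exact congrArg π (Subtype.ext (S'.qCommute l i hl (by omega) h1 hi)))
    (fun l hl hlN => S.independent l hl (Nat.le_of_lt_succ hlN))
    -- At level j the graph is the image of A_{j-1} under φ and χ jointly, and φ is injective.
    (fun b hb => by
      obtain ⟨r, hr⟩ := exists_eq_of_mem_below (f := φ.prod χ) (x := fun i => (E.x j i, w i))
        (fun l h1 h => Prod.ext (S.map_X l h1 h) (hχ l h1 h)) hb
      have h0 : φ r = 0 := congrArg Prod.fst hr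
      have hb' : χ r = b := congrArg Prod.snd hr
      rw [← hb', (injective_iff_map_eq_zero φ).1 S.injective r h0, map_zero])
    (Nat.le_succ_of_le hN) le_rfl
  obtain ⟨g, hg⟩ := exists_algHom_of_graph hfun
  refine ⟨g.comp (Subalgebra.inclusion (E.alg_eq j).le), fun l h1 hl => ?_⟩
  exact (hg l h1 (Nat.lt_succ_of_le hl)).trans (hw l h1 hl)

end DeletingDerivations

/-! ### Injectivity and images of the maps of spectra -/

namespace SpectrumMaps

variable {K A F : Type*} [Field K] [Ring A] [Algebra K A] [DivisionRing F] [Algebra K F] {N : ℕ}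
  {D : QuantumNilpotentAlgebra K A N} {ι : A →ₐ[K] F} {E : DeletingDerivations D ι}

theorem mk_surjective {j : ℕ} (h2 : 2 ≤ j) (hN : j ≤ N) :
    Function.Surjective (Ideal.Quotient.mk (E.pivotIdeal j h2 hN)) :=
  Ideal.Quotient.mk_surjective

open Classical in
theorem nonempty (E : DeletingDerivations D ι) (hι : Function.Injective ι) :
    Nonempty (SpectrumMaps E) := by
  choose g hg using fun (j : ℕ) (h2 : 2 ≤ j) (hN : j ≤ N) => E.exists_g hι h2 hN
  exact ⟨{
    g := g
    g_gen := hg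
    ψ := fun j h2 hN P =>
      if hP : E.gen (j + 1) j (Nat.le_of_succ_le h2) hN ∈ P.1 then
        CSpec.pullback (Ideal.Quotient.mk (E.pivotIdeal j h2 hN)) (mk_surjective h2 hN)
          (g j h2 hN : E.alg j →+* E.alg (j + 1) ⧸ E.pivotIdeal j h2 hN) P
          fun a ha => E.mem_of_mem_pivotIdeal h2 hN hP (Ideal.Quotient.eq_zero_iff_mem.1 ha)
      else CSpec.transfer (E.sameFractions hι h2 hN) P hP
    ψ_of_notMem := fun j h2 hN P hP a => by
      rw [dif_neg hP]
      exact (CSpec.mem_transfer (E.sameFractions hι h2 hN) P hP a).trans <|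
        CSpec.mem_fractionSet_iff_eq_mul_inv P (E.sameFractions hι h2 hN).ne_zero _
    ψ_of_mem := fun j h2 hN P hP a => by
      rw [dif_pos hP, CSpec.mem_pullback]
      rfl }⟩

variable (M : SpectrumMaps E) {j : ℕ} (h2 : 2 ≤ j) (hN : j ≤ N)

theorem g_surjective : Function.Surjective (M.g j h2 hN) := by
  have h : ∀ b : E.alg (j + 1),
      Ideal.Quotient.mkₐ K (E.pivotIdeal j h2 hN) b ∈ (M.g j h2 hN).range := by
    rintro ⟨b, hb⟩
    induction hb using Algebra.adjoin_induction with
    | mem a ha =>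
      obtain ⟨l, h1, hl, rfl⟩ := ha
      exact ⟨E.gen j l h1 hl, M.g_gen j h2 hN l h1 hl⟩
    | algebraMap c =>
      have := (AlgHom.commutes (Ideal.Quotient.mkₐ K (E.pivotIdeal j h2 hN)) c).symm ▸
        Subalgebra.algebraMap_mem (M.g j h2 hN).range c
      exact this
    | add a b ha hb iha ihb =>
      have := add_mem iha ihb
      rw [← map_add] at this
      exact this
    | mul a b ha hb iha ihb =>
      have := mul_mem iha ihb
      rw [← map_mul] at this
      exact this
  intro y
  obtain ⟨b, rfl⟩ := Ideal.Quotient.mk_surjective y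
  exact h b

theorem ψ_eq_transfer (hι : Function.Injective ι) {P : CSpec (E.alg (j + 1))}
    (hP : E.gen (j + 1) j (Nat.le_of_succ_le h2) hN ∉ P.1) :
    M.ψ j h2 hN P = CSpec.transfer (E.sameFractions hι h2 hN) P hP :=
  CSpec.ext_mem fun a => by
    rw [M.ψ_of_notMem j h2 hN P hP]
    exact ((CSpec.mem_transfer (E.sameFractions hι h2 hN) P hP a).trans <|
      CSpec.mem_fractionSet_iff_eq_mul_inv P (E.sameFractions hι h2 hN).ne_zero _).symm

theorem mem_ψ_iff {P : CSpec (E.alg (j + 1))}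
    (hP : E.gen (j + 1) j (Nat.le_of_succ_le h2) hN ∈ P.1) {a : E.alg j} {b : E.alg (j + 1)}
    (h : Ideal.Quotient.mk (E.pivotIdeal j h2 hN) b = M.g j h2 hN a) :
    a ∈ (M.ψ j h2 hN P).1 ↔ b ∈ P.1 := by
  rw [M.ψ_of_mem j h2 hN P hP]
  exact (CSpec.mem_pullback _ (mk_surjective h2 hN) (M.g j h2 hN).toRingHom P
    (fun a ha => E.mem_of_mem_pivotIdeal h2 hN hP (Ideal.Quotient.eq_zero_iff_mem.1 ha)) a).symm.trans
    (CSpec.mem_pullback_iff _ (mk_surjective h2 hN) (M.g j h2 hN).toRingHom P _ h)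

theorem gen_eq : (E.gen j j (Nat.le_of_succ_le h2) hN : F) = E.x (j + 1) j :=
  E.x_of_ge j j h2 le_rfl hN

/-- The two cases in the definition of ψ_j thus have disjoint images, and injectivity and range can
be settled case by case. -/
theorem gen_mem_ψ_iff (hι : Function.Injective ι) (P : CSpec (E.alg (j + 1))) :
    E.gen j j (Nat.le_of_succ_le h2) hN ∈ (M.ψ j h2 hN P).1 ↔
      E.gen (j + 1) j (Nat.le_of_succ_le h2) hN ∈ P.1 := by
  by_cases hP : E.gen (j + 1) j (Nat.le_of_succ_le h2) hN ∈ P.1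
  · exact M.mem_ψ_iff h2 hN hP (M.g_gen j h2 hN j (Nat.le_of_succ_le h2) hN).symm
  · rw [M.ψ_eq_transfer h2 hN hι hP]
    refine iff_of_false ?_ hP
    have h := CSpec.notMem_transfer (E.sameFractions hι h2 hN) P hP
    rwa [show E.gen j j (Nat.le_of_succ_le h2) hN = ⟨E.x (j + 1) j,
      (E.sameFractions hι h2 hN).mem_right⟩ from Subtype.ext (gen_eq h2 hN)]

theorem ψ_injective (hι : Function.Injective ι) : Function.Injective (M.ψ j h2 hN) := by
  intro P P' h
  by_cases hP : E.gen (j + 1) j (Nat.le_of_succ_le h2) hN ∈ P.1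
  · have hP' : E.gen (j + 1) j (Nat.le_of_succ_le h2) hN ∈ P'.1 := by
      rwa [← M.gen_mem_ψ_iff h2 hN hι, ← h, M.gen_mem_ψ_iff h2 hN hι]
    refine CSpec.ext_mem fun b => ?_
    obtain ⟨a, ha⟩ := M.g_surjective h2 hN (Ideal.Quotient.mk (E.pivotIdeal j h2 hN) b)
    rw [← M.mem_ψ_iff h2 hN hP ha.symm, h, M.mem_ψ_iff h2 hN hP' ha.symm]
  · have hP' : E.gen (j + 1) j (Nat.le_of_succ_le h2) hN ∉ P'.1 := by
      rwa [← M.gen_mem_ψ_iff h2 hN hι, ← h, M.gen_mem_ψ_iff h2 hN hι]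
    rw [M.ψ_eq_transfer h2 hN hι hP, M.ψ_eq_transfer h2 hN hι hP'] at h
    have h1 := CSpec.transfer_transfer (E.sameFractions hι h2 hN) P hP
    have h2 := CSpec.transfer_transfer (E.sameFractions hι h2 hN) P' hP'
    rw [← h1, ← h2]
    congr 1

theorem mem_range_ψ_iff (hι : Function.Injective ι) (Q : CSpec (E.alg j)) :
    Q ∈ Set.range (M.ψ j h2 hN) ↔ E.gen j j (Nat.le_of_succ_le h2) hN ∉ Q.1 ∨
      TwoSidedIdeal.ker (M.g j h2 hN) ≤ Q.1 := by
  constructor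
  · rintro ⟨P, rfl⟩
    rw [M.gen_mem_ψ_iff h2 hN hι]
    by_cases hP : E.gen (j + 1) j (Nat.le_of_succ_le h2) hN ∈ P.1
    · refine Or.inr fun a ha => ?_
      rw [TwoSidedIdeal.mem_ker] at ha
      rw [M.mem_ψ_iff h2 hN hP (b := 0) (by rw [ha, map_zero])]
      exact P.1.zero_mem
    · exact Or.inl hP
  · intro h
    by_cases hQ : E.gen j j (Nat.le_of_succ_le h2) hN ∈ Q.1
    · have hker := h.resolve_left (not_not.2 hQ)
      -- The roles of g_j and the quotient map are exchanged: g_j is surjective with kernel in Q, so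
      -- Q is pushed forward along g_j and pulled back to A^{(j+1)}.
      let P : CSpec (E.alg (j + 1)) := CSpec.pullback (M.g j h2 hN).toRingHom
        (M.g_surjective h2 hN) (Ideal.Quotient.mk (E.pivotIdeal j h2 hN)) Q
        fun a ha => hker ((TwoSidedIdeal.mem_ker _).2 ha)
      have hmem : ∀ {a : E.alg j} {b : E.alg (j + 1)},
          Ideal.Quotient.mk (E.pivotIdeal j h2 hN) b = M.g j h2 hN a → (b ∈ P.1 ↔ a ∈ Q.1) :=
        fun h => CSpec.mem_pullback_iff _ _ _ Q _ h.symm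
      have hP : E.gen (j + 1) j (Nat.le_of_succ_le h2) hN ∈ P.1 :=
        (hmem (M.g_gen j h2 hN j (Nat.le_of_succ_le h2) hN).symm).2 hQ
      refine ⟨P, CSpec.ext_mem fun a => ?_⟩
      obtain ⟨b, hb⟩ := Ideal.Quotient.mk_surjective (M.g j h2 hN a)
      rw [M.mem_ψ_iff h2 hN hP hb, hmem hb]
    · have hF := E.sameFractions hι h2 hN
      have hQ' : (⟨E.x (j + 1) j, hF.mem_right⟩ : E.alg j) ∉ Q.1 := by
        rwa [show (⟨E.x (j + 1) j, hF.mem_right⟩ : E.alg j) =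
          E.gen j j (Nat.le_of_succ_le h2) hN from Subtype.ext (gen_eq h2 hN).symm]
      exact ⟨CSpec.transfer hF.symm Q hQ',
        (M.ψ_eq_transfer h2 hN hι (CSpec.notMem_transfer hF.symm Q hQ')).trans
          (CSpec.transfer_transfer hF.symm Q hQ')⟩

theorem toBase_succ (P : CSpec (E.alg (j + 1))) :
    M.toBase (j + 1) (Nat.le_succ_of_le h2) (Nat.succ_le_succ hN) P =
      M.toBase j h2 (Nat.le_succ_of_le hN) (M.ψ j h2 hN P) := by
  obtain ⟨k, rfl⟩ := Nat.exists_eq_add_of_le' h2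
  rfl

theorem toBase_injective (hι : Function.Injective ι) {j : ℕ} (h2 : 2 ≤ j) :
    ∀ hN : j ≤ N + 1, Function.Injective (M.toBase j h2 hN) := by
  induction j, h2 using Nat.le_induction with
  | base => exact fun _ => Function.injective_id
  | succ j h2 ih =>
    intro hN P P' h
    rw [M.toBase_succ h2 (Nat.le_of_succ_le_succ hN), M.toBase_succ h2 (Nat.le_of_succ_le_succ hN)] at h
    exact M.ψ_injective h2 _ hι (ih _ h)

theorem range_toBase_antitone {j k : ℕ} (h2 : 2 ≤ j) (hjk : j ≤ k) :
    ∀ hN : k ≤ N + 1, Set.range (M.toBase k (h2.trans hjk) hN) ⊆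
      Set.range (M.toBase j h2 (hjk.trans hN)) := by
  induction k, hjk using Nat.le_induction with
  | base => exact fun _ => subset_rfl
  | succ k hjk ih =>
    rintro hN _ ⟨P, rfl⟩
    refine ih (Nat.le_of_succ_le hN) ⟨M.ψ k (h2.trans hjk) (Nat.le_of_succ_le_succ hN) P, ?_⟩
    exact (M.toBase_succ (h2.trans hjk) (Nat.le_of_succ_le_succ hN) P).symm

/-- Injectivity of `toBase` makes the condition on all preimages of Q a condition on the unique one.
-/
theorem mem_range_toBase_succ_iff (hι : Function.Injective ι) (Q : CSpec (E.alg 2)) :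
    Q ∈ Set.range (M.toBase (j + 1) (Nat.le_succ_of_le h2) (Nat.succ_le_succ hN)) ↔
      Q ∈ Set.range (M.toBase j h2 (Nat.le_succ_of_le hN)) ∧
        ∀ P : CSpec (E.alg j), M.toBase j h2 (Nat.le_succ_of_le hN) P = Q →
          (E.gen j j (Nat.le_of_succ_le h2) hN ∉ P.1 ∨
            TwoSidedIdeal.ker (M.g j h2 hN) ≤ P.1) := by
  constructor
  · intro hQ
    refine ⟨M.range_toBase_antitone h2 (Nat.le_succ j) _ hQ, fun P hP => ?_⟩
    obtain ⟨P', rfl⟩ := hQ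
    rw [M.toBase_succ h2 hN] at hP
    rw [M.toBase_injective hι h2 _ hP]
    exact (M.mem_range_ψ_iff h2 hN hι _).1 ⟨P', rfl⟩
  · rintro ⟨⟨P, hP⟩, h⟩
    obtain ⟨P', rfl⟩ := (M.mem_range_ψ_iff h2 hN hι P).2 (h P hP)
    exact ⟨P', (M.toBase_succ h2 hN P').trans hP⟩

theorem mem_range_canonicalEmbedding_iff (hι : Function.Injective ι) (Q : CSpec (E.alg 2)) :
    Q ∈ Set.range M.canonicalEmbedding ↔
      ∀ (j : ℕ) (h2 : 2 ≤ j) (hN : j ≤ N),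
        Q ∈ Set.range (M.toBase j h2 (Nat.le_succ_of_le hN)) ∧
        ∀ P : CSpec (E.alg j), M.toBase j h2 (Nat.le_succ_of_le hN) P = Q →
          (E.gen j j (Nat.le_of_succ_le h2) hN ∉ P.1 ∨
            TwoSidedIdeal.ker (M.g j h2 hN) ≤ P.1) := by
  constructor
  · intro hQ j h2 hN
    exact (M.mem_range_toBase_succ_iff h2 hN hι Q).1
      (M.range_toBase_antitone (Nat.le_succ_of_le h2) (Nat.succ_le_succ hN) _ hQ)
  · intro h
    rcases Nat.lt_or_ge N 2 with hN | hN
    · obtain rfl : N = 1 := le_antisymm (Nat.le_of_lt_succ hN) D.one_le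
      exact ⟨Q, rfl⟩
    -- The instance j = N alone suffices, as membership in the image of f_{N-1} carries the
    -- conditions for smaller j.
    · exact (M.mem_range_toBase_succ_iff hN le_rfl hι Q).2 (h N hN le_rfl)

end SpectrumMaps

theorem proposition3p9 {K A F : Type*} [Field K] [Ring A] [Algebra K A] [DivisionRing F]
    [Algebra K F] {N : ℕ} (D : QuantumNilpotentAlgebra K A N) (ι : A →ₐ[K] F)
    (hι : IsDivisionRingOfFractions ι) :
    Nonempty (DeletingDerivations D ι) ∧
    ∀ E : DeletingDerivations D ι,
      Nonempty (SpectrumMaps E) ∧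
      ∀ M : SpectrumMaps E,
        (∀ (j : ℕ) (h2 : 2 ≤ j) (hN : j ≤ N + 1), Function.Injective (M.toBase j h2 hN)) ∧
        ∀ Q : CSpec (E.alg 2),
          Q ∈ Set.range M.canonicalEmbedding ↔
            ∀ (j : ℕ) (h2 : 2 ≤ j) (hN : j ≤ N),
              Q ∈ Set.range (M.toBase j h2 (Nat.le_succ_of_le hN)) ∧
              ∀ P : CSpec (E.alg j), M.toBase j h2 (Nat.le_succ_of_le hN) P = Q →
                (E.gen j j (Nat.le_of_succ_le h2) hN ∉ P.1 ∨
                  TwoSidedIdeal.ker (M.g j h2 hN) ≤ P.1) :=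
  ⟨DeletingDerivations.nonempty D ι hι.injective, fun E =>
    ⟨SpectrumMaps.nonempty E hι.injective, fun M =>
      ⟨fun _ h2 hN => M.toBase_injective hι.injective h2 hN,
        M.mem_range_canonicalEmbedding_iff hι.injective⟩⟩⟩
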